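/- Let $P$ be a regular $n$-gon with unit circumradius, $n\ge 5$, with vertices $p_1,\dots,p_n$ in counterclockwise order and sides $S_i=p_ip_{i+1}$ (indices mod $n$). A convex polygon $Q$ is \emph{circumscribed} about $P$ if $P\subseteq Q$ and every vertex of $P$ lies on the boundary of $Q$; let $A(P)=\sup\{\operatorname{area}(Q): Q \text{ circumscribed about } P\}$, and call $Q$ a \emph{maximum area polygon circumscribed about} $P$ if $Q$ is circumscribed about $P$ and $\operatorname{area}(Q)=A(P)$. The \emph{sequence assigned to} $Q$ is the word in $\{U,N\}^n$ whose $i$-th letter is $U$ if $S_i$ is contained in the boundary of $Q$ (used), and $N$ otherwise (not used). Then $A(P)$ is finite and the following hold. \begin{enumerate} \item If $2\mid n$, then \[A(P)=n\tan\frac{\pi}{n}+\frac n2\,\frac{\sin^4\frac{\pi}{n}}{\cos^2\frac{\pi}{n}}\tan\frac{2\pi}{n},\] and the sequence assigned to a maximum area polygon circumscribed about $P$ is $w=(UN)^{n/2}=UNUN\ldots UN$. \item If $4\mid n-1$, then \[A(P)=n\tan\frac{\pi}{n}+\frac{\sin^4\frac{\pi}{n}}{\cos^2\frac{\pi}{n}}\left(\frac{n+3}{4}\tan\frac{2\pi}{n}-\tan\frac{3\pi}{2n}\right),\]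 and the sequence assigned to a maximum area polygon circumscribed about $P$ is $w=U\,N^{\frac{n-5}{2}}\,(UN)^{\frac{n+3}{4}}$. \item If $4\mid n+1$, then \[A(P)=n\tan\frac{\pi}{n}+\frac{\sin^4\frac{\pi}{n}}{\cos^2\frac{\pi}{n}}\left(\frac{n+1}{4}\tan\frac{2\pi}{n}-\tan\frac{\pi}{2n}\right),\] and the sequence assigned to a maximum area polygon circumscribed about $P$ is $w=U\,N^{\frac{n-3}{2}}\,(UN)^{\frac{n+1}{4}}$. \end{enumerate} Here the assertion about sequences means that there is a maximum area polygon circumscribed about $P$ with assigned sequence exactly $w$, and that the sequence assigned to every maximum area polygon circumscribed about $P$ is a cyclic shift of $w$. -/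

import Mathlib

open MeasureTheory

noncomputable section

namespace CircumscribedPolygon

/-- The Euclidean plane. -/
abbrev Plane : Type := EuclideanSpace ℝ (Fin 2)

/-- A (solid, nondegenerate) convex polygon: the convex hull of finitely many points, with nonempty
interior. -/
def IsConvexPolygon (Q : Set Plane) : Prop :=
  (∃ F : Set Plane, F.Finite ∧ Q = convexHull ℝ F) ∧ (interior Q).Nonempty

/-- The area of a plane set: its Lebesgue measure. -/
def area (Q : Set Plane) : ℝ := (volume Q).toReal

/-- `Q` is circumscribed about the convex polygon with vertices `p i`, `i : ZMod n`: it is a convex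
polygon that contains the polygon and has all the points `p i` on its boundary. -/
def IsCircumscribed {n : ℕ} (p : ZMod n → Plane) (Q : Set Plane) : Prop :=
  IsConvexPolygon Q ∧ convexHull ℝ (Set.range p) ⊆ Q ∧ ∀ i, p i ∈ frontier Q

/-- The set of areas of the polygons circumscribed about the polygon with vertices `p i`. -/
def circumscribedAreas {n : ℕ} (p : ZMod n → Plane) : Set ℝ :=
  {a | ∃ Q, IsCircumscribed p Q ∧ area Q = a}

/-- `A(P)`: the supremum of the areas of circumscribed polygons. -/
def maxArea {n : ℕ} (p : ZMod n → Plane) : ℝ := sSup (circumscribedAreas p)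

/-- `Q` is a maximum area polygon circumscribed about the polygon with vertices `p i`. -/
def IsMaxAreaCircumscribed {n : ℕ} (p : ZMod n → Plane) (Q : Set Plane) : Prop :=
  IsCircumscribed p Q ∧ area Q = maxArea p

/-- The labels "used" and "not used". -/
inductive Label : Type
  | U : Label
  | N : Label

/-- The side joining `p i` and `p (i + 1)`, with indices modulo `n`. -/
def side {n : ℕ} (p : ZMod n → Plane) (i : ZMod n) : Set Plane := segment ℝ (p i) (p (i + 1))

open Classical in
/-- The label of the `i`-th side: used by `Q` if it lies on the boundary of `Q`. -/
def sideLabel {n : ℕ} (p : ZMod n → Plane) (Q : Set Plane) (i : ZMod n) : Label :=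
  if side p i ⊆ frontier Q then Label.U else Label.N

/-- The sequence of length `n` of the labels of the sides, in the order of the vertices. -/
def assignedSequence {n : ℕ} (p : ZMod n → Plane) (Q : Set Plane) : List Label :=
  List.ofFn fun i : Fin n => sideLabel p Q ((i : ℕ) : ZMod n)

/-- The points `p i` are the vertices, in counterclockwise order, of a regular `n`-gon with unit
circumradius (with arbitrary center `c` and arbitrary position). -/
def IsUnitRegularNgon {n : ℕ} (p : ZMod n → Plane) : Prop :=
  ∃ (c : Plane) (φ : ℝ), ∀ k : ℕ,
    p (k : ZMod n) =
      c + !₂[Real.cos (φ + 2 * Real.pi * k / n), Real.sin (φ + 2 * Real.pi * k / n)]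

/-- The word `UNUN…UN` consisting of `k` blocks `UN`. -/
def wordUN (k : ℕ) : List Label := (List.replicate k [Label.U, Label.N]).flatten

/-- The word `U N…N UNUN…UN` with `m` letters `N` after the first `U`, followed by `k` blocks
`UN`. -/
def wordUNUN (m k : ℕ) : List Label := Label.U :: (List.replicate m Label.N ++ wordUN k)

end CircumscribedPolygon

end

/-! Put α = π/n and M = 1 − cos 2α. A polygon Q circumscribed about P has a supporting line at each
vertex, and this line lies between the lines of the two adjacent sides, so it is recorded by a
parameter z i in [-1, 1] (`Frame.exists_slopes`). Over side i, the lines at its two ends cut off a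
corner. Together with the centre, that sector has area sin(2α)/2 · (1 + excess), where the excess
depends on the two parameters only. Summing over the sectors bounds the area of Q (`Frame.area_le`).
Conversely, the hull of the apices, the vertices and the centre is circumscribed and reaches the
bound (`Frame.exists_isCircumscribed`). So the problem is to maximize `totalExcess` over a cube, and
in a maximum area polygon the used sides are exactly those of excess zero (`Frame.side_subset_iff`).

A maximizer exists by compactness. Stationarity at a vertex says that the vertex bisects the edge of
Q through it. In terms of the excesses h this is a linear recurrence, h i + 2 cos(2α) h (i+1) + h
(i+2) = 2M, valid wherever h (i+1) > 0 (`recurrence_of_isMax`). Its constant solution is tan² α, and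
the deviations oscillate as (-1)^i times sinusoids of frequency 2α. Between two consecutive zeros, a
block of l sides, this determines the sum of h − tan² α: it is −tan³ α cot(lα) for odd l, tan³ α tan
2α for l = 2, and nonpositive for other even l. Positivity inside an odd block also forces lα < π/2
+ 2α.

Blocks of two sides have the strictly largest mean (`IsBlock.sum_le`), which settles even n. For odd
n some block is odd. Taking one odd block of length l and giving the remaining sides the mean of
blocks of two leads to `oddValue`. The identity tan(a+b) − tan a − tan b = tan a tan b tan(a+b)
gives the sign of its increments and shows that the largest odd l below n/2 is the unique best one
(`oddValue_lt`). A cycle without zeros has sum zero and loses. The bounds are attained by explicit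
solutions of the recurrence (`extremalSeq`), from which the slopes are recovered
(`exists_excess_eq`). -/

noncomputable section

namespace CircumscribedPolygon

/-! ### The excess over a single side -/

/-- The area of the corner of a circumscribed polygon beyond a side, relative to the area of the
triangle spanned by the centre and that side; `A` and `B` measure the inclinations of the supporting
lines at the two ends of the side. -/
def excess (A B : ℝ) : ℝ := A * B / (A + B - A * B)

theorem excess_comm (A B : ℝ) : excess A B = excess B A := by
  unfold excess; rw [mul_comm, add_comm]

@[simp] theorem excess_zero_left (B : ℝ) : excess 0 B = 0 := by simp [excess]

@[simp] theorem excess_zero_right (A : ℝ) : excess A 0 = 0 := by simp [excess]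

/-- Average AB ≤ 2MA and AB ≤ 2MB. With M < 1 this keeps the denominator of `excess` positive away
from the origin. -/
theorem mul_le_of_le_two_mul {M A B : ℝ} (hA : 0 ≤ A) (hB : 0 ≤ B)
    (hA' : A ≤ 2 * M) (hB' : B ≤ 2 * M) : A * B ≤ M * (A + B) := by
  nlinarith [mul_nonneg hA (sub_nonneg.2 hB'), mul_nonneg hB (sub_nonneg.2 hA')]

theorem excess_denom_pos {M A B : ℝ} (hM : M < 1) (hA : 0 ≤ A) (hB : 0 ≤ B)
    (hA' : A ≤ 2 * M) (hB' : B ≤ 2 * M) (h : 0 < A + B) : 0 < A + B - A * B := by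
  nlinarith [mul_le_of_le_two_mul hA hB hA' hB', mul_pos (sub_pos.2 hM) h]

theorem excess_nonneg {M A B : ℝ} (hM : M < 1) (hA : 0 ≤ A) (hB : 0 ≤ B)
    (hA' : A ≤ 2 * M) (hB' : B ≤ 2 * M) : 0 ≤ excess A B := by
  rcases (add_nonneg hA hB).lt_or_eq with h | h
  · exact div_nonneg (mul_nonneg hA hB) (excess_denom_pos hM hA hB hA' hB' h).le
  · have : A = 0 := by linarith
    simp [this]

theorem excess_pos_iff {M A B : ℝ} (hM : M < 1) (hA : 0 ≤ A) (hB : 0 ≤ B)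
    (hA' : A ≤ 2 * M) (hB' : B ≤ 2 * M) : 0 < excess A B ↔ 0 < A ∧ 0 < B := by
  constructor
  · intro h
    refine ⟨hA.lt_of_ne ?_, hB.lt_of_ne ?_⟩ <;> rintro rfl <;> simp at h
  · rintro ⟨h1, h2⟩
    exact div_pos (mul_pos h1 h2) (excess_denom_pos hM hA hB hA' hB' (by linarith))

theorem excess_le {M A B : ℝ} (hM : M < 1) (hA : 0 ≤ A) (hB : 0 ≤ B)
    (hA' : A ≤ 2 * M) (hB' : B ≤ 2 * M) : excess A B ≤ (A + B) / (1 - M) := by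
  have h1M : 0 < 1 - M := by linarith
  rcases (add_nonneg hA hB).lt_or_eq with h | h
  · have h1 := mul_le_of_le_two_mul hA hB hA' hB'
    unfold excess
    rw [div_le_div_iff₀ (excess_denom_pos hM hA hB hA' hB' h) h1M]
    nlinarith [mul_nonneg hA hB, mul_pos h1M h, sq_nonneg A, sq_nonneg B]
  · have : A = 0 := by linarith
    simp [this]; positivity

/-- Only the origin, where the quotient is 0/0, is delicate; there the linear bound `excess_le`
squeezes the function to 0. -/
theorem continuousOn_excess {M : ℝ} (hM : M < 1) :
    ContinuousOn (fun x : ℝ × ℝ => excess x.1 x.2)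
      (Set.Icc 0 (2 * M) ×ˢ Set.Icc 0 (2 * M)) := by
  rintro ⟨A, B⟩ ⟨⟨hA, hA'⟩, hB, hB'⟩
  simp only at hA hA' hB hB'
  rcases (add_nonneg hA hB).lt_or_eq with h | h
  · have hd := (excess_denom_pos hM hA hB hA' hB' h).ne'
    apply ContinuousAt.continuousWithinAt
    unfold excess
    exact ContinuousAt.div (by fun_prop) (by fun_prop) hd
  · obtain ⟨rfl, rfl⟩ : A = 0 ∧ B = 0 := ⟨by linarith, by linarith⟩
    unfold ContinuousWithinAt
    simp only [excess_zero_left]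
    have hlim : Filter.Tendsto (fun x : ℝ × ℝ => (x.1 + x.2) / (1 - M))
        (nhdsWithin (0, 0) (Set.Icc 0 (2 * M) ×ˢ Set.Icc 0 (2 * M))) (nhds 0) := by
      have : Continuous (fun x : ℝ × ℝ => (x.1 + x.2) / (1 - M)) := by fun_prop
      have h2 := (this.tendsto (0, 0)).mono_left (nhdsWithin_le_nhds
        (s := Set.Icc 0 (2 * M) ×ˢ Set.Icc 0 (2 * M)))
      simpa using h2
    refine squeeze_zero' ?_ ?_ hlim
    · filter_upwards [self_mem_nhdsWithin] with x hx
      exact excess_nonneg hM hx.1.1 hx.2.1 hx.1.2 hx.2.2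
    · filter_upwards [self_mem_nhdsWithin] with x hx
      exact excess_le hM hx.1.1 hx.2.1 hx.1.2 hx.2.2

/-- The derivative is the square of an apex coordinate (the u of `exists_apex`), which gives
stationarity its geometric form. -/
theorem hasDerivAt_excess_right {A B : ℝ} (h : A + B - A * B ≠ 0) :
    HasDerivAt (fun x => excess A x) ((A / (A + B - A * B)) ^ 2) B := by
  have h1 : HasDerivAt (fun x : ℝ => A * x) A B := by
    simpa using (hasDerivAt_id B).const_mul A
  have h2 : HasDerivAt (fun x : ℝ => A + x - A * x) (1 - A) B :=
    ((hasDerivAt_id B).const_add A).sub h1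
  refine (h1.div h2 h).congr_deriv ?_
  rw [div_pow]
  congr 1
  ring

theorem excess_lt_excess_right {M A B B' : ℝ} (hM : M < 1) (hA : 0 < A) (hB : 0 ≤ B)
    (hA' : A ≤ 2 * M) (hB' : B' ≤ 2 * M) (h : B < B') : excess A B < excess A B' := by
  unfold excess
  rw [div_lt_div_iff₀ (excess_denom_pos hM hA.le hB hA' (by linarith) (by linarith))
    (excess_denom_pos hM hA.le (by linarith) hA' hB' (by linarith))]
  nlinarith [mul_pos (mul_pos hA hA) (sub_pos.2 h)]

/-! ### Optimality conditions for the slopes -/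

/-- At an optimal supporting line through a common vertex of two sides, the excess over the second
side is an affine function of the position of the apex over the first one. -/
theorem excess_eq_of_forall_le {M A B s : ℝ} (hM0 : 0 < M) (hM : M < 1) (hA : 0 < A) (hB : 0 ≤ B)
    (hA' : A ≤ 2 * M) (hB' : B ≤ 2 * M) (hs : -1 < s) (hs' : s ≤ 1)
    (hmax : ∀ r ∈ Set.Icc (-1 : ℝ) 1, excess A (M * (1 + r)) + excess (M * (1 - r)) B ≤
      excess A (M * (1 + s)) + excess (M * (1 - s)) B) :
    excess (M * (1 - s)) B =
      1 + (A - M * (1 + s) - 2 * (1 - M) * A) / (A + M * (1 + s) - A * (M * (1 + s))) := by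
  have hb : 0 < M * (1 + s) := mul_pos hM0 (by linarith)
  have hb' : M * (1 + s) ≤ 2 * M := by nlinarith
  have ha0 : 0 ≤ M * (1 - s) := mul_nonneg hM0.le (by linarith)
  have ha' : M * (1 - s) ≤ 2 * M := by nlinarith
  have hD := excess_denom_pos hM hA.le hb.le hA' hb' (by linarith)
  rcases hs'.lt_or_eq with hs1 | rfl
  · have ha : 0 < M * (1 - s) := mul_pos hM0 (by linarith)
    rcases hB.lt_or_eq with hB0 | rfl
    · have hE := excess_denom_pos hM ha.le hB ha' hB' (by linarith)
      have hE' : B + M * (1 - s) - B * (M * (1 - s)) ≠ 0 := by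
        rw [add_comm B, mul_comm B]; exact hE.ne'
      have d1 : HasDerivAt (fun r : ℝ => M * (1 + r)) M s := by
        simpa using ((hasDerivAt_id s).const_add 1).const_mul M
      have d2 : HasDerivAt (fun r : ℝ => M * (1 - r)) (-M) s := by
        simpa using ((hasDerivAt_id s).const_sub 1).const_mul M
      have d3 := HasDerivAt.comp s (hasDerivAt_excess_right hD.ne') d1
      have d4 := HasDerivAt.comp s (hasDerivAt_excess_right hE') d2
      have hloc : IsLocalMax (((fun x => excess A x) ∘ fun r : ℝ => M * (1 + r)) +
          ((fun x => excess B x) ∘ fun r : ℝ => M * (1 - r))) s := by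
        filter_upwards [Icc_mem_nhds hs hs1] with r hr
        simpa [excess_comm B] using hmax r hr
      have h0 := hloc.hasDerivAt_eq_zero (d3.add d4)
      -- The two bases are proportional to the distances of the neighbouring apices from the ray
      -- through the common vertex. Their equality means that the vertex bisects the edge between
      -- the apices.
      have hsq : (A / (A + M * (1 + s) - A * (M * (1 + s)))) ^ 2 =
          (B / (B + M * (1 - s) - B * (M * (1 - s)))) ^ 2 := by
        apply mul_right_cancel₀ hM0.ne'
        linarith
      have hE2 : 0 < B + M * (1 - s) - B * (M * (1 - s)) := by
        rw [add_comm B, mul_comm B]; exact hE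
      have hu := (sq_eq_sq₀ (div_pos hA hD).le (div_pos hB0 hE2).le).1 hsq
      rw [excess_comm]
      unfold excess
      rw [mul_div_right_comm, ← hu]
      have hD' := hD.ne'
      generalize hDD : A + M * (1 + s) - A * (M * (1 + s)) = D at *
      field_simp
      rw [← hDD]
      ring
    -- With B = 0 the second excess vanishes for every slope, so turning the line to r = 1 costs
    -- nothing and strictly enlarges the first.
    · exfalso
      have h1 := hmax 1 ⟨by norm_num, le_rfl⟩
      have h2 := excess_lt_excess_right (B' := M * (1 + 1)) hM hA hb.le hA' (by linarith)
        (by nlinarith)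
      simp only [excess_zero_right, add_zero] at h1
      linarith
  -- At the endpoint s = 1 there is no stationarity condition, but both sides of the formula vanish.
  · have : M * (1 - 1) = 0 := by ring
    rw [this, excess_zero_left]
    have hD' := hD.ne'
    generalize hDD : A + M * (1 + 1) - A * (M * (1 + 1)) = D at *
    field_simp
    rw [← hDD]
    ring

/-- Every nonnegative solution of the recurrence on its support is the family of excesses of some
choice of slopes. -/
theorem exists_excess_eq {n : ℕ} {M : ℝ} (hM0 : 0 < M) {h : ZMod n → ℝ}
    (h0 : ∀ i, 0 ≤ h i)
    (hrec : ∀ i, 0 < h (i + 1) → h i + 2 * (1 - M) * h (i + 1) + h (i + 1 + 1) = 2 * M)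
    (hzero : ∀ i, h (i + 1) = 0 → 0 < h i ∨ 0 < h (i + 1 + 1)) :
    ∃ z : ZMod n → ℝ, (∀ i, z i ∈ Set.Icc (-1 : ℝ) 1) ∧
      ∀ i, excess (M * (1 - z i)) (M * (1 + z (i + 1))) = h i := by
  -- When a vertex bisects its edge, the heights of the two apices over their sides are in the ratio
  -- of the inclinations, so 1 + z i : 1 − z i = h (i−1) : h i. Next to a zero this gives ±1, and
  -- 0/0 = 0 still lies in the interval.
  refine ⟨fun i => (h (i - 1) - h i) / (h (i - 1) + h i), fun i => ?_, fun i => ?_⟩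
  · have h1 := h0 i
    have h2 := h0 (i - 1)
    rcases (add_nonneg h2 h1).lt_or_eq with h | h
    · constructor
      · rw [le_div_iff₀ h]; linarith
      · rw [div_le_iff₀ h]; linarith
    · simp [← h]
  · obtain ⟨i, rfl⟩ : ∃ j, i = j + 1 := ⟨i - 1, by ring⟩
    simp only [add_sub_cancel_right]
    have a0 := h0 i
    have a2 := h0 (i + 1 + 1)
    rcases (h0 (i + 1)).lt_or_eq with h1 | h1
    · have hr := hrec i h1
      generalize h i = x at *
      generalize h (i + 1) = y at *
      generalize h (i + 1 + 1) = w at *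
      have e1 : M * (1 - (x - y) / (x + y)) = 2 * M * y / (x + y) := by
        field_simp; ring
      have e2 : M * (1 + (y - w) / (y + w)) = 2 * M * y / (y + w) := by
        field_simp; ring
      rw [e1, e2]
      unfold excess
      have e3 : 2 * M * y / (x + y) + 2 * M * y / (y + w) -
          2 * M * y / (x + y) * (2 * M * y / (y + w)) =
          (2 * M) * y * (2 * M) / ((x + y) * (y + w)) := by
        field_simp
        linear_combination hr
      rw [e3]
      field_simp
    · rw [← h1]
      rcases hzero i h1.symm with h | h
      · simp [h.ne']
      · simp [h.ne']

variable {n : ℕ} [NeZero n]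

/-- The total excess of the polygon whose supporting line at the `i`-th vertex has slope
parameter `z i`. -/
def totalExcess (M : ℝ) (z : ZMod n → ℝ) : ℝ :=
  ∑ i, excess (M * (1 - z i)) (M * (1 + z (i + 1)))

theorem slope_mem_Icc {M r : ℝ} (hM : 0 ≤ M) (hr : r ∈ Set.Icc (-1 : ℝ) 1) :
    0 ≤ M * (1 - r) ∧ M * (1 - r) ≤ 2 * M ∧ 0 ≤ M * (1 + r) ∧ M * (1 + r) ≤ 2 * M := by
  obtain ⟨h1, h2⟩ := hr
  refine ⟨mul_nonneg hM (by linarith), by nlinarith, mul_nonneg hM (by linarith), by nlinarith⟩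

theorem exists_isMaxOn_totalExcess {M : ℝ} (hM0 : 0 ≤ M) (hM : M < 1) :
    ∃ z : ZMod n → ℝ, (∀ i, z i ∈ Set.Icc (-1 : ℝ) 1) ∧
      ∀ w : ZMod n → ℝ, (∀ i, w i ∈ Set.Icc (-1 : ℝ) 1) → totalExcess M w ≤ totalExcess M z := by
  have hK : IsCompact (Set.univ.pi fun _ : ZMod n => Set.Icc (-1 : ℝ) 1) :=
    isCompact_univ_pi fun _ => isCompact_Icc
  have hc : ContinuousOn (totalExcess (n := n) M)
      (Set.univ.pi fun _ : ZMod n => Set.Icc (-1 : ℝ) 1) := by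
    unfold totalExcess
    refine continuousOn_finsetSum _ fun i _ => ?_
    refine (continuousOn_excess hM).comp (f := fun z : ZMod n → ℝ =>
      (M * (1 - z i), M * (1 + z (i + 1)))) (by fun_prop) ?_
    intro z hz
    have h1 := slope_mem_Icc hM0 (hz i trivial)
    have h2 := slope_mem_Icc hM0 (hz (i + 1) trivial)
    exact ⟨⟨h1.1, h1.2.1⟩, h2.2.2⟩
  obtain ⟨z, hz, hmax⟩ := hK.exists_isMaxOn ⟨fun _ => 0, fun _ _ => by simp⟩ hc
  exact ⟨z, fun i => hz i trivial, fun w hw => hmax fun i _ => hw i⟩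

/-- Changing one slope parameter only affects the two sides at that vertex. -/
theorem totalExcess_update (hn : 2 ≤ n) (M : ℝ) (z : ZMod n → ℝ) (i : ZMod n) (r : ℝ) :
    totalExcess M (Function.update z (i + 1) r) - totalExcess M z =
      (excess (M * (1 - z i)) (M * (1 + r)) + excess (M * (1 - r)) (M * (1 + z (i + 1 + 1)))) -
      (excess (M * (1 - z i)) (M * (1 + z (i + 1))) +
        excess (M * (1 - z (i + 1))) (M * (1 + z (i + 1 + 1)))) := by
  have : Fact (1 < n) := ⟨hn⟩
  have hne : ∀ j : ZMod n, j ≠ j + 1 := fun j h => one_ne_zero (left_eq_add.1 h)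
  unfold totalExcess
  rw [← Finset.sum_sub_distrib]
  rw [← Finset.sum_subset (Finset.subset_univ {i, i + 1})]
  · rw [Finset.sum_pair (hne i)]
    simp only [Function.update_self, Function.update_of_ne (hne i),
      Function.update_of_ne (hne (i + 1)).symm]
    ring
  · intro j _ hj
    simp only [Finset.mem_insert, Finset.mem_singleton, not_or] at hj
    rw [Function.update_of_ne hj.2, Function.update_of_ne (fun h => hj.1 (add_right_cancel h)),
      sub_self]

/-- By `excess_eq_of_forall_le`, applied at both ends of a side of positive excess, the two
neighbouring excesses are affine in the coordinates (u, v) of its apex. In their sum the terms ±(u −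
v) cancel, and u + v is 1 plus the middle excess. -/
theorem recurrence_of_isMax (hn : 2 ≤ n) {M : ℝ} (hM0 : 0 < M) (hM : M < 1) {z : ZMod n → ℝ}
    (hz : ∀ i, z i ∈ Set.Icc (-1 : ℝ) 1)
    (hmax : ∀ w : ZMod n → ℝ, (∀ i, w i ∈ Set.Icc (-1 : ℝ) 1) →
      totalExcess M w ≤ totalExcess M z) (i : ZMod n)
    (hi : 0 < excess (M * (1 - z (i + 1))) (M * (1 + z (i + 1 + 1)))) :
    excess (M * (1 - z i)) (M * (1 + z (i + 1))) +
      2 * (1 - M) * excess (M * (1 - z (i + 1))) (M * (1 + z (i + 1 + 1))) +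
      excess (M * (1 - z (i + 1 + 1))) (M * (1 + z (i + 1 + 1 + 1))) = 2 * M := by
  have hloc : ∀ (j : ZMod n), ∀ r ∈ Set.Icc (-1 : ℝ) 1,
      excess (M * (1 - z j)) (M * (1 + r)) + excess (M * (1 - r)) (M * (1 + z (j + 1 + 1))) ≤
      excess (M * (1 - z j)) (M * (1 + z (j + 1))) +
        excess (M * (1 - z (j + 1))) (M * (1 + z (j + 1 + 1))) := by
    intro j r hr
    have h1 := totalExcess_update hn M z j r
    have h2 := hmax (Function.update z (j + 1) r) fun k => by
      rcases eq_or_ne k (j + 1) with rfl | hk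
      · simpa using hr
      · simpa [hk] using hz k
    linarith
  have b := fun j => slope_mem_Icc hM0.le (hz j)
  obtain ⟨hA, hB⟩ := (excess_pos_iff hM (b _).1 (b _).2.2.1 (b _).2.1 (b _).2.2.2).1 hi
  have hR := excess_eq_of_forall_le (s := z (i + 1 + 1)) hM0 hM hA (b (i + 1 + 1 + 1)).2.2.1
    (b _).2.1 (b _).2.2.2 (by nlinarith) (hz _).2 (hloc (i + 1))
  -- The left neighbour is the mirror image: reversing the orientation negates the slopes.
  have hL := excess_eq_of_forall_le (s := - z (i + 1)) (A := M * (1 + z (i + 1 + 1)))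
    (B := M * (1 - z i)) hM0 hM hB (b i).1
    (b _).2.2.2 (b _).2.1 (by nlinarith) (by linarith [(hz (i + 1)).1]) (by
      intro r hr
      have := hloc i (-r) ⟨by linarith [hr.2], by linarith [hr.1]⟩
      simp only [sub_neg_eq_add, ← sub_eq_add_neg] at this ⊢
      rw [excess_comm _ (M * (1 - r)), excess_comm (M * (1 + r)), add_comm] at this
      rw [excess_comm _ (M * (1 - z (i + 1))), excess_comm (M * (1 + z (i + 1))),
        add_comm (excess (M * (1 - z (i + 1))) _)]
      exact this)
  simp only [sub_neg_eq_add, ← sub_eq_add_neg] at hL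
  rw [excess_comm] at hL
  rw [hL, hR]
  have hD := excess_denom_pos hM hA.le hB.le (b _).2.1 (b _).2.2.2 (by linarith)
  generalize M * (1 - z (i + 1)) = A at *
  generalize M * (1 + z (i + 1 + 1)) = B at *
  unfold excess
  have e : B + A - B * A = A + B - A * B := by ring
  rw [e]
  have hD' := hD.ne'
  generalize hDD : A + B - A * B = D at *
  field_simp
  rw [← hDD]
  ring

/-! ### Solving the recurrence on one block -/

/-- The excesses over a maximal run of unused sides, between two used ones: the sides `0` and `l`
are used, and those in between satisfy the recurrence of optimal polygons. -/
structure IsBlock (α : ℝ) (l : ℕ) (h : ℕ → ℝ) : Prop where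
  pos : 0 < l
  left : h 0 = 0
  right : h l = 0
  inner : ∀ i, 0 < i → i < l → 0 < h i
  recurrence : ∀ i, i + 1 < l →
    h i + 2 * Real.cos (2 * α) * h (i + 1) + h (i + 2) = 2 * (1 - Real.cos (2 * α))

section trig

variable {α : ℝ}

theorem tan_sq_mul_one_add_cos (hc : Real.cos α ≠ 0) :
    Real.tan α ^ 2 * (1 + Real.cos (2 * α)) = 1 - Real.cos (2 * α) := by
  rw [Real.cos_two_mul, Real.tan_eq_sin_div_cos]
  field_simp
  rw [Real.sin_sq]; ring

theorem tan_mul_one_add_cos (hc : Real.cos α ≠ 0) :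
    Real.tan α * (1 + Real.cos (2 * α)) = Real.sin (2 * α) := by
  rw [Real.cos_two_mul, Real.sin_two_mul, Real.tan_eq_sin_div_cos]
  field_simp
  ring

theorem neg_cot_eq_tan (x : ℝ) : - (Real.cos x / Real.sin x) = Real.tan (x - Real.pi / 2) := by
  rw [Real.tan_eq_sin_div_cos, Real.sin_sub_pi_div_two, Real.cos_sub_pi_div_two, neg_div]

end trig

namespace IsBlock

variable {α : ℝ} {l : ℕ} {h : ℕ → ℝ}

/-- The explicit solution of the recurrence. -/
theorem exists_eq (hb : IsBlock α l h) (hc : Real.cos α ≠ 0) (hs : Real.sin (2 * α) ≠ 0) :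
    ∃ R : ℝ, ∀ i ≤ l, h i = Real.tan α ^ 2 +
      (-1) ^ i * (-Real.tan α ^ 2 * Real.cos (2 * α * i) + R * Real.sin (2 * α * i)) := by
  have hT := tan_sq_mul_one_add_cos hc
  -- The characteristic roots are −exp(±2iα), and tan² α is the constant solution. The cosine
  -- coefficient is fixed by h 0 = 0, and R is fitted to h 1.
  refine ⟨((1 - Real.cos (2 * α)) - h 1) / Real.sin (2 * α), fun i => ?_⟩
  induction i using Nat.strong_induction_on with
  | _ i ih =>
    intro hi
    match i, ih, hi with
    | 0, _, _ => simp [hb.left]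
    | 1, _, _ =>
      simp only [Nat.cast_one, mul_one, pow_one]
      field_simp
      linear_combination -hT
    | i + 2, ih, hi =>
      have h0 := ih i (by omega) (by omega)
      have h1 := ih (i + 1) (by omega) (by omega)
      have hr := hb.recurrence i (by omega)
      rw [h0, h1] at hr
      have e1 : 2 * α * ((i + 1 : ℕ) : ℝ) = 2 * α * i + 2 * α := by push_cast; ring
      have e2 : 2 * α * ((i + 2 : ℕ) : ℝ) = 2 * α * i + 2 * α + 2 * α := by push_cast; ring
      rw [e1, Real.cos_add, Real.sin_add] at hr
      rw [e2, Real.cos_add (_ + _), Real.sin_add (_ + _), Real.cos_add (2 * α * i),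
        Real.sin_add (2 * α * i)]
      generalize (((1 - Real.cos (2 * α)) - h 1) / Real.sin (2 * α)) = R at *
      have hsc := Real.sin_sq_add_cos_sq (2 * α)
      generalize Real.cos (2 * α * i) = x at *
      generalize Real.sin (2 * α * i) = y at *
      generalize Real.tan α ^ 2 = T at *
      rw [pow_add, pow_one] at hr
      rw [pow_add]
      generalize Real.cos (2 * α) = c at *
      generalize Real.sin (2 * α) = s at *
      linear_combination hr - 2 * hT + (-1) ^ i * (R * y - T * x) * hsc

/-- Adding the recurrence over the block counts each inner term with the full coefficient 2(1 + cos
2α), so that only terms at the ends of the block remain. -/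
theorem sum_eq (hb : IsBlock α l h) (hc : Real.cos α ≠ 0) :
    (∑ i ∈ Finset.range l, (h i - Real.tan α ^ 2)) * (2 * (1 + Real.cos (2 * α))) =
      h 1 + h (l - 1) - 2 * (1 - Real.cos (2 * α)) := by
  have hT := tan_sq_mul_one_add_cos hc
  have key : ∀ m, m + 1 ≤ l →
      (∑ i ∈ Finset.range (m + 1), (h i - Real.tan α ^ 2)) * (2 * (1 + Real.cos (2 * α))) =
      h 1 + h m - h (m + 1) - 2 * (1 - Real.cos (2 * α)) := by
    intro m
    induction m with
    | zero =>
      intro _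
      simp only [zero_add, Finset.sum_range_one, hb.left]
      linear_combination -2 * hT
    | succ m ih =>
      intro hm
      rw [Finset.sum_range_succ, add_mul, ih (by omega)]
      have hr := hb.recurrence m (by omega)
      linear_combination hr - 2 * hT
  have := key (l - 1) (by have := hb.pos; omega)
  rw [Nat.sub_add_cancel hb.pos, hb.right] at this
  linarith

/-- The total of a block with an odd number of sides. -/
theorem sum_of_odd (hb : IsBlock α l h) (hα : 0 < α) (hα' : 2 * α < Real.pi / 2)
    (hl : l * α ≤ Real.pi) (hodd : Odd l) :
    ∑ i ∈ Finset.range l, (h i - Real.tan α ^ 2) =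
      - Real.tan α ^ 3 * (Real.cos (l * α) / Real.sin (l * α)) ∧
    l * α < Real.pi / 2 + 2 * α := by
  have hpi := Real.pi_pos
  have hc : 0 < Real.cos α := Real.cos_pos_of_mem_Ioo ⟨by linarith, by linarith⟩
  have hs : 0 < Real.sin (2 * α) := Real.sin_pos_of_pos_of_lt_pi (by linarith) (by linarith)
  have hc2 : 0 < Real.cos (2 * α) := Real.cos_pos_of_mem_Ioo ⟨by linarith, by linarith⟩
  have ht : 0 < Real.tan α := Real.tan_pos_of_pos_of_lt_pi_div_two hα (by linarith)
  have hT := tan_sq_mul_one_add_cos hc.ne'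
  have hT' := tan_mul_one_add_cos hc.ne'
  have hsum := hb.sum_eq hc.ne'
  obtain ⟨R, hR⟩ := hb.exists_eq hc.ne' hs.ne'
  have hl0 : (0 : ℝ) < l := by exact_mod_cast hb.pos
  have hθ : 0 < l * α := by positivity
  have e1 := hR 1 hb.pos
  have el := hR l le_rfl
  have em := hR (l - 1) (by omega)
  have heven : Even (l - 1) := by obtain ⟨k, rfl⟩ := hodd; exact ⟨k, by omega⟩
  rw [hodd.neg_one_pow, hb.right] at el
  rw [heven.neg_one_pow, Nat.cast_sub hb.pos, Nat.cast_one] at em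
  simp only [pow_one, Nat.cast_one, mul_one] at e1
  have a1 : 2 * α * (l : ℝ) = l * α + l * α := by ring
  have a2 : 2 * α * ((l : ℝ) - 1) = (l * α + l * α) - 2 * α := by ring
  rw [a1, Real.cos_add, Real.sin_add] at el
  rw [a2, Real.cos_sub, Real.sin_sub, Real.cos_add, Real.sin_add] at em
  have hsc := Real.sin_sq_add_cos_sq (l * α)
  -- For odd l the end condition h l = 0 factors as cos(lα)(R sin(lα) − tan² α cos(lα)) = 0. If the
  -- first factor vanishes, R stays undetermined but drops out of the sum.
  by_cases hcos : Real.cos (l * α) = 0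
  · have hlt : l * α = Real.pi / 2 := by
      rw [← Real.cos_pi_div_two] at hcos
      exact Real.injOn_cos ⟨hθ.le, hl⟩ ⟨by linarith, by linarith⟩ hcos
    refine ⟨?_, by linarith⟩
    rw [hcos] at em hsc ⊢
    apply mul_right_cancel₀ (b := 2 * (1 + Real.cos (2 * α))) (by positivity)
    rw [hsum, e1, em]
    linear_combination 2 * hT +
      (Real.tan α ^ 2 * Real.cos (2 * α) + R * Real.sin (2 * α)) * hsc
  · have hfac : R * Real.sin (l * α) = Real.tan α ^ 2 * Real.cos (l * α) := by
      apply mul_left_cancel₀ hcos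
      linear_combination (1 / 2) * el - (Real.tan α ^ 2 / 2) * hsc
    have hsin : Real.sin (l * α) ≠ 0 := by
      intro h0
      rw [h0, mul_zero] at hfac
      exact (mul_ne_zero (by positivity) hcos) hfac.symm
    have hsin0 : 0 < Real.sin (l * α) :=
      (Real.sin_nonneg_of_nonneg_of_le_pi hθ.le hl).lt_of_ne hsin.symm
    have hR' : R = Real.tan α ^ 2 * (Real.cos (l * α) / Real.sin (l * α)) := by
      field_simp; linarith
    refine ⟨?_, ?_⟩
    · apply mul_right_cancel₀ (b := 2 * (1 + Real.cos (2 * α))) (by positivity)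
      rw [hsum, e1, em]
      have h3 : - Real.tan α ^ 3 * (Real.cos (l * α) / Real.sin (l * α)) *
          (2 * (1 + Real.cos (2 * α))) = - 2 * R * Real.sin (2 * α) := by
        rw [hR', ← hT']; ring
      rw [h3]
      have ex1 : -Real.tan α ^ 2 * (Real.cos (l * α) * Real.cos (l * α) -
          Real.sin (l * α) * Real.sin (l * α)) + R * (Real.sin (l * α) * Real.cos (l * α) +
          Real.cos (l * α) * Real.sin (l * α)) = Real.tan α ^ 2 := by
        linear_combination 2 * Real.cos (l * α) * hfac + Real.tan α ^ 2 * hsc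
      have ex2 : -Real.tan α ^ 2 * (Real.sin (l * α) * Real.cos (l * α) +
          Real.cos (l * α) * Real.sin (l * α)) - R * (Real.cos (l * α) * Real.cos (l * α) -
          Real.sin (l * α) * Real.sin (l * α)) = - R := by
        linear_combination 2 * Real.sin (l * α) * hfac - R * hsc
      linear_combination 2 * hT + Real.cos (2 * α) * ex1 + Real.sin (2 * α) * ex2
    · rcases Nat.lt_or_ge l 3 with h3 | h3
      · have : l = 1 := by obtain ⟨k, rfl⟩ := hodd; omega
        rw [this]; push_cast; linarith
      -- Multiplied by sin(lα), the inequality h 2 > 0 becomes cos(lα − 2α) > 0, which bounds the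
      -- length.
      · have h2 := hb.inner 2 (by norm_num) (by omega)
        rw [hR 2 (by omega)] at h2
        have a3 : 2 * α * ((2 : ℕ) : ℝ) = 2 * α + 2 * α := by push_cast; ring
        rw [a3, Real.cos_add, Real.sin_add] at h2
        have hsc2 := Real.sin_sq_add_cos_sq (2 * α)
        have h5 : 0 < (Real.tan α ^ 2 * (2 * Real.sin (2 * α))) *
            (Real.cos (l * α - 2 * α)) := by
          rw [Real.cos_sub]
          have := mul_pos hsin0 h2
          calc _ < _ := this
            _ = _ := by
              linear_combination (2 * Real.sin (2 * α) * Real.cos (2 * α)) * hfac -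
                Real.sin (l * α) * Real.tan α ^ 2 * hsc2
        have h6 : 0 < Real.cos (l * α - 2 * α) := pos_of_mul_pos_right h5 (by positivity)
        by_contra hge
        push Not at hge
        have := Real.cos_nonpos_of_pi_div_two_le_of_le (x := l * α - 2 * α) (by linarith)
          (by linarith)
        linarith

/-- A block with an even number of sides, more than two, has nonpositive total. -/
theorem sum_of_even (hb : IsBlock α l h) (hα : 0 < α) (hα' : 2 * α < Real.pi / 2)
    (hl : l * α ≤ Real.pi) (heven : Even l) :
    (l = 2 ∧ ∑ i ∈ Finset.range l, (h i - Real.tan α ^ 2) =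
      Real.tan α ^ 3 * Real.tan (2 * α)) ∨
    ∑ i ∈ Finset.range l, (h i - Real.tan α ^ 2) ≤ 0 := by
  have hpi := Real.pi_pos
  have hc : 0 < Real.cos α := Real.cos_pos_of_mem_Ioo ⟨by linarith, by linarith⟩
  have hs : 0 < Real.sin (2 * α) := Real.sin_pos_of_pos_of_lt_pi (by linarith) (by linarith)
  have hc2 : 0 < Real.cos (2 * α) := Real.cos_pos_of_mem_Ioo ⟨by linarith, by linarith⟩
  have ht : 0 < Real.tan α := Real.tan_pos_of_pos_of_lt_pi_div_two hα (by linarith)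
  have hT := tan_sq_mul_one_add_cos hc.ne'
  have hT' := tan_mul_one_add_cos hc.ne'
  have hsum := hb.sum_eq hc.ne'
  obtain ⟨R, hR⟩ := hb.exists_eq hc.ne' hs.ne'
  have hl0 : (0 : ℝ) < l := by exact_mod_cast hb.pos
  have hθ : 0 < l * α := by positivity
  have e1 := hR 1 hb.pos
  have el := hR l le_rfl
  have em := hR (l - 1) (by omega)
  have hodd : Odd (l - 1) := by
    obtain ⟨k, rfl⟩ := heven
    have := hb.pos
    exact ⟨k - 1, by omega⟩
  rw [heven.neg_one_pow, hb.right] at el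
  rw [hodd.neg_one_pow, Nat.cast_sub hb.pos, Nat.cast_one] at em
  simp only [pow_one, Nat.cast_one, mul_one] at e1
  have a1 : 2 * α * (l : ℝ) = l * α + l * α := by ring
  have a2 : 2 * α * ((l : ℝ) - 1) = (l * α + l * α) - 2 * α := by ring
  rw [a1, Real.cos_add, Real.sin_add] at el
  rw [a2, Real.cos_sub, Real.sin_sub, Real.cos_add, Real.sin_add] at em
  have hsc := Real.sin_sq_add_cos_sq (l * α)
  have hfac : Real.sin (l * α) * (R * Real.cos (l * α) +
      Real.tan α ^ 2 * Real.sin (l * α)) = 0 := by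
    linear_combination (-1 / 2) * el + (Real.tan α ^ 2 / 2) * hsc
  have hpos : 0 < 2 * (1 + Real.cos (2 * α)) := by positivity
  -- If sin(lα) = 0 the sum is 0 for every R; otherwise R = −tan² α tan(lα).
  rcases mul_eq_zero.1 hfac with hsin | hfac
  · right
    rw [hsin] at em hsc
    have : (∑ i ∈ Finset.range l, (h i - Real.tan α ^ 2)) * (2 * (1 + Real.cos (2 * α))) = 0 := by
      rw [hsum, e1, em]
      linear_combination 2 * hT +
        (Real.tan α ^ 2 * Real.cos (2 * α) + R * Real.sin (2 * α)) * hsc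
    rcases mul_eq_zero.1 this with h0 | h0
    · exact h0.le
    · exact absurd h0 hpos.ne'
  · have hcos : Real.cos (l * α) ≠ 0 := by
      intro h0
      rw [h0] at hfac hsc
      have : Real.tan α ^ 2 * Real.sin (l * α) ^ 2 = 0 := by
        linear_combination Real.sin (l * α) * hfac
      have h1 : Real.sin (l * α) ^ 2 = 1 := by linarith
      rw [h1] at this
      have := pow_pos ht 2
      linarith
    have hR' : R = - Real.tan α ^ 2 * Real.tan (l * α) := by
      rw [Real.tan_eq_sin_div_cos (l * α)]
      field_simp; linarith
    have hS : ∑ i ∈ Finset.range l, (h i - Real.tan α ^ 2) =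
        Real.tan α ^ 3 * Real.tan (l * α) := by
      apply mul_right_cancel₀ (b := 2 * (1 + Real.cos (2 * α))) hpos.ne'
      rw [hsum, e1, em]
      have h3 : Real.tan α ^ 3 * Real.tan (l * α) *
          (2 * (1 + Real.cos (2 * α))) = - 2 * R * Real.sin (2 * α) := by
        rw [hR', ← hT']; ring
      rw [h3]
      have ex1 : -Real.tan α ^ 2 * (Real.cos (l * α) * Real.cos (l * α) -
          Real.sin (l * α) * Real.sin (l * α)) + R * (Real.sin (l * α) * Real.cos (l * α) +
          Real.cos (l * α) * Real.sin (l * α)) = - Real.tan α ^ 2 := by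
        linear_combination 2 * Real.sin (l * α) * hfac - Real.tan α ^ 2 * hsc
      have ex2 : -Real.tan α ^ 2 * (Real.sin (l * α) * Real.cos (l * α) +
          Real.cos (l * α) * Real.sin (l * α)) - R * (Real.cos (l * α) * Real.cos (l * α) -
          Real.sin (l * α) * Real.sin (l * α)) = R := by
        linear_combination -2 * Real.cos (l * α) * hfac + R * hsc
      linear_combination 2 * hT - Real.cos (2 * α) * ex1 - Real.sin (2 * α) * ex2
    rcases Nat.lt_or_ge l 3 with h3 | h3
    · have h2 : l = 2 := by
        obtain ⟨k, rfl⟩ := heven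
        have := hb.pos
        omega
      left
      refine ⟨h2, ?_⟩
      rw [hS, h2]; norm_num
    · right
      rw [hS]
      apply mul_nonpos_of_nonneg_of_nonpos (by positivity)
      have hl4 : 4 ≤ l := by obtain ⟨k, rfl⟩ := heven; omega
      have hl4' : (4 : ℝ) ≤ l := by exact_mod_cast hl4
      have h2 := hb.inner 2 (by norm_num) (by omega)
      rw [hR 2 (by omega)] at h2
      have a3 : 2 * α * ((2 : ℕ) : ℝ) = 2 * α + 2 * α := by push_cast; ring
      rw [a3, Real.cos_add, Real.sin_add] at h2
      have hsc2 := Real.sin_sq_add_cos_sq (2 * α)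
      -- If tan(lα) > 0 then cos(lα) > 0, and h 2 > 0 times cos(lα) reads sin(lα − 2α) < 0,
      -- impossible for an angle in [0, π].
      by_contra hpos'
      push Not at hpos'
      have hsin0 : 0 ≤ Real.sin (l * α) := Real.sin_nonneg_of_nonneg_of_le_pi hθ.le hl
      have hcos0 : 0 < Real.cos (l * α) := by
        by_contra hcn
        push Not at hcn
        have : Real.tan (l * α) ≤ 0 := by
          rw [Real.tan_eq_sin_div_cos]
          exact div_nonpos_of_nonneg_of_nonpos hsin0 hcn
        linarith
      have h5 : 0 < - (Real.tan α ^ 2 * (2 * Real.sin (2 * α))) *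
          (Real.sin (l * α - 2 * α)) := by
        rw [Real.sin_sub]
        calc _ < _ := mul_pos hcos0 h2
          _ = _ := by
            linear_combination (2 * Real.sin (2 * α) * Real.cos (2 * α)) * hfac -
              Real.cos (l * α) * Real.tan α ^ 2 * hsc2
      have h6 : 0 ≤ Real.sin (l * α - 2 * α) :=
        Real.sin_nonneg_of_nonneg_of_le_pi (by nlinarith) (by linarith)
      have h7 : 0 ≤ (Real.tan α ^ 2 * (2 * Real.sin (2 * α))) * Real.sin (l * α - 2 * α) := by
        positivity
      linarith

theorem neg_cot_lt_tan (hb : IsBlock α l h) (hα : 0 < α) (hα' : 2 * α < Real.pi / 2)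
    (hl : l * α < Real.pi / 2 + 2 * α) :
    - (Real.cos (l * α) / Real.sin (l * α)) < Real.tan (2 * α) := by
  have hl0 : (0 : ℝ) < l := by exact_mod_cast hb.pos
  rw [neg_cot_eq_tan]
  have : 0 < l * α := by positivity
  exact Real.strictMonoOn_tan ⟨by linarith, by linarith⟩
    ⟨by linarith [Real.pi_pos], by linarith⟩ (by linarith)

/-- Blocks of two sides have the largest mean. -/
theorem sum_le (hb : IsBlock α l h) (hα : 0 < α) (hα' : 2 * α < Real.pi / 2)
    (hl : l * α ≤ Real.pi) :
    (l = 2 ∧ ∑ i ∈ Finset.range l, (h i - Real.tan α ^ 2) =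
      Real.tan α ^ 3 * (l / 2 * Real.tan (2 * α))) ∨
    ∑ i ∈ Finset.range l, (h i - Real.tan α ^ 2) <
      Real.tan α ^ 3 * (l / 2 * Real.tan (2 * α)) := by
  have ht : 0 < Real.tan α := Real.tan_pos_of_pos_of_lt_pi_div_two hα (by linarith)
  have ht2 : 0 < Real.tan (2 * α) := Real.tan_pos_of_pos_of_lt_pi_div_two (by linarith) hα'
  have hl0 : (0 : ℝ) < l := by exact_mod_cast hb.pos
  rcases Nat.even_or_odd l with he | ho
  · rcases hb.sum_of_even hα hα' hl he with ⟨h2, h3⟩ | h2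
    · left
      refine ⟨h2, ?_⟩
      rw [h3, h2]; norm_num
    · right
      exact h2.trans_lt (by positivity)
  · right
    obtain ⟨h1, h2⟩ := hb.sum_of_odd hα hα' hl ho
    rw [h1, neg_mul, ← mul_neg]
    apply mul_lt_mul_of_pos_left _ (by positivity)
    -- For l = 1 the left side is negative. For l ≥ 3 it is below tan 2α, while l/2 > 1.
    rcases Nat.lt_or_ge l 3 with h3 | h3
    · have h4 : l = 1 := by obtain ⟨k, rfl⟩ := ho; omega
      have hcos : 0 < Real.cos α := Real.cos_pos_of_mem_Ioo
        ⟨by linarith [Real.pi_pos], by linarith⟩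
      have hsin : 0 < Real.sin α := Real.sin_pos_of_pos_of_lt_pi hα (by linarith [Real.pi_pos])
      rw [h4]
      have : 0 < Real.cos α / Real.sin α := by positivity
      push_cast
      rw [one_mul]
      linarith
    · have h4 := hb.neg_cot_lt_tan hα hα' h2
      have h5 : (3 : ℝ) ≤ l := by exact_mod_cast h3
      nlinarith

end IsBlock

/-! ### Cutting a sequence at its zeros -/

theorem exists_first_zero {H : ℕ → ℝ} {m : ℕ} (hm : 0 < m) (hH : H m = 0) :
    ∃ l, 0 < l ∧ l ≤ m ∧ H l = 0 ∧ ∀ i, 0 < i → i < l → H i ≠ 0 := by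
  classical
  have hex : ∃ l, 0 < l ∧ H l = 0 := ⟨m, hm, hH⟩
  refine ⟨Nat.find hex, (Nat.find_spec hex).1, Nat.find_min' hex ⟨hm, hH⟩,
    (Nat.find_spec hex).2, fun i hi hil h0 => Nat.find_min hex hil ⟨hi, h0⟩⟩

/-- The gaps between successive zeros add up to an odd number, so one of them is odd; an even first
gap is peeled off by induction. -/
theorem exists_odd_gap {m : ℕ} : ∀ {H : ℕ → ℝ}, Odd m → H 0 = 0 → H m = 0 →
    ∃ a l, a + l ≤ m ∧ Odd l ∧ H a = 0 ∧ H (a + l) = 0 ∧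
      ∀ i, 0 < i → i < l → H (a + i) ≠ 0 := by
  induction m using Nat.strong_induction_on with
  | _ m ih =>
    intro H hm h0 hHm
    obtain ⟨l, hl, hlm, hHl, hin⟩ := exists_first_zero hm.pos hHm
    rcases Nat.even_or_odd l with he | ho
    · obtain ⟨a, l', h1, h2, h3, h4, h5⟩ := ih (m - l) (by omega) (H := fun i => H (l + i))
        (Nat.Odd.sub_even hlm hm he) (by simpa using hHl) (by simpa [Nat.add_sub_cancel' hlm])
      refine ⟨l + a, l', by omega, h2, h3, ?_, fun i hi hil => ?_⟩
      · rw [add_assoc]; exact h4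
      · rw [add_assoc]; exact h5 i hi hil
    · exact ⟨0, l, by simpa using hlm, ho, h0, by simpa using hHl,
        fun i hi hil => by simpa using hin i hi hil⟩

/-- A nonnegative sequence that satisfies the recurrence of optimal polygons wherever it is
positive. -/
structure IsExcessSeq (α : ℝ) (H : ℕ → ℝ) : Prop where
  nonneg : ∀ i, 0 ≤ H i
  recurrence : ∀ i, 0 < H (i + 1) →
    H i + 2 * Real.cos (2 * α) * H (i + 1) + H (i + 2) = 2 * (1 - Real.cos (2 * α))

namespace IsExcessSeq

variable {α : ℝ} {H : ℕ → ℝ}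

theorem shift (hH : IsExcessSeq α H) (a : ℕ) : IsExcessSeq α fun i => H (a + i) :=
  ⟨fun _ => hH.nonneg _, fun i hi => hH.recurrence (a + i) hi⟩

theorem isBlock (hH : IsExcessSeq α H) {l : ℕ} (hl : 0 < l) (h0 : H 0 = 0) (hHl : H l = 0)
    (hin : ∀ i, 0 < i → i < l → H i ≠ 0) : IsBlock α l H :=
  ⟨hl, h0, hHl, fun i hi hil => (hH.nonneg i).lt_of_ne (hin i hi hil).symm,
    fun i hi => hH.recurrence i
      ((hH.nonneg _).lt_of_ne (hin (i + 1) (Nat.succ_pos _) hi).symm)⟩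

/-- Split off the block ending at the first positive zero and apply `IsBlock.sum_le`. Equality must
hold for every block, so all blocks have two sides. -/
theorem sum_le {m : ℕ} (hα : 0 < α) (hα' : 2 * α < Real.pi / 2) :
    ∀ {H : ℕ → ℝ}, IsExcessSeq α H → m * α ≤ Real.pi → H 0 = 0 → H m = 0 →
    ∑ i ∈ Finset.range m, (H i - Real.tan α ^ 2) ≤
      Real.tan α ^ 3 * (m / 2 * Real.tan (2 * α)) ∧
    (∑ i ∈ Finset.range m, (H i - Real.tan α ^ 2) =
      Real.tan α ^ 3 * (m / 2 * Real.tan (2 * α)) →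
      Even m ∧ ∀ j < m, H j = 0 ↔ Even j) := by
  induction m using Nat.strong_induction_on with
  | _ m ih =>
    intro H hH hm h0 hHm
    rcases Nat.eq_zero_or_pos m with rfl | hm0
    · simp
    obtain ⟨l, hl, hlm, hHl, hin⟩ := exists_first_zero hm0 hHm
    have hb := hH.isBlock hl h0 hHl hin
    have hlm' : (l : ℝ) ≤ m := by exact_mod_cast hlm
    have hlpi : l * α ≤ Real.pi := by nlinarith
    have hcast : ((m - l : ℕ) : ℝ) = m - l := Nat.cast_sub hlm
    obtain ⟨i1, i2⟩ := ih (m - l) (by omega) (hH.shift l)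
      (by rw [hcast]; nlinarith [(Nat.cast_nonneg l : (0 : ℝ) ≤ l)])
      (by simpa using hHl) (by simpa [Nat.add_sub_cancel' hlm])
    have hsplit : ∑ i ∈ Finset.range m, (H i - Real.tan α ^ 2) =
        ∑ i ∈ Finset.range l, (H i - Real.tan α ^ 2) +
        ∑ i ∈ Finset.range (m - l), (H (l + i) - Real.tan α ^ 2) := by
      rw [← Finset.sum_range_add, Nat.add_sub_cancel' hlm]
    rw [hcast] at i1 i2
    have hrhs : Real.tan α ^ 3 * (m / 2 * Real.tan (2 * α)) =
        Real.tan α ^ 3 * (l / 2 * Real.tan (2 * α)) +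
        Real.tan α ^ 3 * ((m - l) / 2 * Real.tan (2 * α)) := by ring
    rw [hsplit, hrhs]
    rcases hb.sum_le hα hα' hlpi with ⟨hl2, hs⟩ | hs
    · rw [hs]
      refine ⟨by linarith, fun he => ?_⟩
      obtain ⟨hev, hpat⟩ := i2 (by linarith)
      subst hl2
      refine ⟨(Nat.even_sub hlm).1 hev |>.2 even_two, fun j hj => ?_⟩
      match j with
      | 0 => simp [h0]
      | 1 => simpa using hin 1 one_pos one_lt_two
      | j + 2 =>
        have := hpat j (by omega)
        rw [add_comm 2 j] at this
        rw [this, Nat.even_add]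
        simp
    · exact ⟨by linarith, fun he => by linarith⟩

end IsExcessSeq

/-! ### The best length of an odd block -/

section compare

/-- The product form shows the sign of the increments of `oddValue`. -/
theorem tan_sub_tan_sub_tan {a b : ℝ} (ha : Real.cos a ≠ 0) (hb : Real.cos b ≠ 0)
    (hab : Real.cos (a + b) ≠ 0) :
    Real.tan (a + b) - Real.tan a - Real.tan b =
      Real.tan a * Real.tan b * Real.tan (a + b) := by
  simp only [Real.tan_eq_sin_div_cos]
  field_simp
  rw [Real.sin_add, Real.cos_add]
  ring_nf

variable {n : ℕ} {α : ℝ}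

/-- The value, up to a factor, of a polygon with one block of `l` sides and otherwise blocks of two
sides. -/
def oddValue (α : ℝ) (n l : ℕ) : ℝ :=
  - (Real.cos (l * α) / Real.sin (l * α)) + ((n : ℝ) - l) / 2 * Real.tan (2 * α)

theorem oddValue_add_two_sub (α : ℝ) (n l : ℕ) :
    oddValue α n (l + 2) - oddValue α n l =
      Real.tan (l * α - Real.pi / 2 + 2 * α) - Real.tan (l * α - Real.pi / 2) -
        Real.tan (2 * α) := by
  unfold oddValue
  rw [neg_cot_eq_tan, neg_cot_eq_tan]
  push_cast
  ring_nf

/-- While l + 2 < n/2, both lα − π/2 and (l+2)α − π/2 are negative, so the increment is a product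
with two negative factors. Once l + 2 passes n/2, one factor changes sign. -/
theorem oddValue_lt_add_two (hα : n * α = Real.pi) (hα0 : 0 < α) {l : ℕ} (hl : 0 < l)
    (h : 2 * (l + 2) < n) : oddValue α n l < oddValue α n (l + 2) := by
  have h1 : (2 * (l + 2) : ℝ) < n := by exact_mod_cast h
  have h2 : (0 : ℝ) < l := by exact_mod_cast hl
  have hl0 : 0 < l * α := by positivity
  have h3 : 2 * (l * α) + 4 * α < Real.pi := by rw [← hα]; nlinarith
  rw [← sub_pos, oddValue_add_two_sub, tan_sub_tan_sub_tan]
  · have t1 : Real.tan (l * α - Real.pi / 2) < 0 :=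
      Real.tan_neg_of_neg_of_pi_div_two_lt (by linarith) (by linarith)
    have t2 : Real.tan (l * α - Real.pi / 2 + 2 * α) < 0 :=
      Real.tan_neg_of_neg_of_pi_div_two_lt (by linarith) (by linarith)
    have t3 : 0 < Real.tan (2 * α) :=
      Real.tan_pos_of_pos_of_lt_pi_div_two (by linarith) (by linarith)
    nlinarith [mul_pos (mul_pos_of_neg_of_neg t1 t2) t3]
  all_goals exact (Real.cos_pos_of_mem_Ioo ⟨by linarith, by linarith⟩).ne'

theorem oddValue_add_two_lt (hα : n * α = Real.pi) (hα0 : 0 < α) (hα' : 2 * α < Real.pi / 2)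
    {l : ℕ} (hl : 0 < l) (hln : 2 * l < n)
    (h : n < 2 * (l + 2)) : oddValue α n (l + 2) < oddValue α n l := by
  have h1 : (n : ℝ) < 2 * (l + 2) := by exact_mod_cast h
  have h1' : 2 * (l : ℝ) < n := by exact_mod_cast hln
  have h2 : (0 : ℝ) < l := by exact_mod_cast hl
  have hl0 : 0 < l * α := by positivity
  have h3 : Real.pi < 2 * (l * α) + 4 * α := by rw [← hα]; nlinarith
  have h4 : 2 * (l * α) < Real.pi := by rw [← hα]; nlinarith
  rw [← sub_neg, oddValue_add_two_sub, tan_sub_tan_sub_tan]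
  · have t1 : Real.tan (l * α - Real.pi / 2) < 0 :=
      Real.tan_neg_of_neg_of_pi_div_two_lt (by linarith) (by linarith)
    have t2 : 0 < Real.tan (l * α - Real.pi / 2 + 2 * α) :=
      Real.tan_pos_of_pos_of_lt_pi_div_two (by linarith) (by linarith)
    have t3 : 0 < Real.tan (2 * α) :=
      Real.tan_pos_of_pos_of_lt_pi_div_two (by linarith) (by linarith)
    exact mul_neg_of_neg_of_pos (mul_neg_of_neg_of_pos t1 t3) t2
  all_goals exact (Real.cos_pos_of_mem_Ioo ⟨by linarith, by linarith⟩).ne'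

theorem oddValue_lt_add_two_mul (hα : n * α = Real.pi) (hα0 : 0 < α) {l : ℕ} (hl : 0 < l) (k : ℕ)
    (h : 2 * (l + 2 * (k + 1)) < n) : oddValue α n l < oddValue α n (l + 2 * (k + 1)) := by
  induction k with
  | zero => exact oddValue_lt_add_two hα hα0 hl (by omega)
  | succ k ih =>
    exact (ih (by omega)).trans (oddValue_lt_add_two hα hα0 (by omega) (by omega))

/-- The largest odd number below `n / 2` is the best length of an odd block. -/
theorem oddValue_lt (hα : n * α = Real.pi) (hα0 : 0 < α) (hα' : 2 * α < Real.pi / 2)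
    {l m : ℕ} (hl : Odd l) (hm : Odd m) (hm1 : 2 * m < n) (hm2 : n < 2 * m + 4)
    (hln : 2 * l < n + 4) (hlm : l ≠ m) : oddValue α n l < oddValue α n m := by
  obtain ⟨a, rfl⟩ := hl
  obtain ⟨b, rfl⟩ := hm
  rcases lt_or_gt_of_ne hlm with h | h
  · have := oddValue_lt_add_two_mul hα hα0 (l := 2 * a + 1) (by omega) (b - a - 1) (by omega)
    rwa [show 2 * a + 1 + 2 * (b - a - 1 + 1) = 2 * b + 1 by omega] at this
  · obtain rfl : a = b + 1 := by omega
    exact oddValue_add_two_lt hα hα0 hα' (l := 2 * b + 1) (by omega) (by omega) (by omega)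

/-- This rules out the cycles without zeros, whose sum is 0. -/
theorem oddValue_pos (hα : n * α = Real.pi) (hα0 : 0 < α) (hα' : 2 * α < Real.pi / 2)
    {m : ℕ} (hm : Odd m) (hm1 : 2 * m < n) (hm2 : n < 2 * m + 4) (hn : 5 ≤ n) :
    0 < oddValue α n m := by
  -- The value at m + 2 is smaller but visibly positive: (m+2)α exceeds π/2, and m + 2 ≤ n.
  refine lt_trans ?_ (oddValue_add_two_lt hα hα0 hα' hm.pos hm1 (by omega))
  have h1 : (n : ℝ) < 2 * m + 4 := by exact_mod_cast hm2
  have h1' : 2 * (m : ℝ) < n := by exact_mod_cast hm1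
  have h1'' : (m : ℝ) + 2 ≤ n := by exact_mod_cast (by omega : m + 2 ≤ n)
  have h3 : Real.pi < 2 * (m * α) + 4 * α := by rw [← hα]; nlinarith
  have h4 : 2 * (m * α) < Real.pi := by rw [← hα]; nlinarith
  unfold oddValue
  rw [neg_cot_eq_tan]
  push_cast
  have t2 : 0 < Real.tan ((m + 2) * α - Real.pi / 2) :=
    Real.tan_pos_of_pos_of_lt_pi_div_two (by linarith) (by linarith)
  have t3 : 0 < Real.tan (2 * α) :=
    Real.tan_pos_of_pos_of_lt_pi_div_two (by linarith) (by linarith)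
  have : 0 ≤ ((n : ℝ) - (m + 2)) / 2 * Real.tan (2 * α) :=
    mul_nonneg (by linarith) t3.le
  linarith

end compare

/-! ### Cyclic sequences of excesses -/

section cyclic

variable {n : ℕ}

theorem sum_zmod_eq_sum_range [NeZero n] (f : ZMod n → ℝ) (a : ZMod n) :
    ∑ i, f i = ∑ k ∈ Finset.range n, f (a + (k : ℕ)) := by
  rw [← Equiv.sum_comp (Equiv.addLeft a) f, ← Fin.sum_univ_eq_sum_range (fun k => f (a + (k : ℕ))),
    ← Equiv.sum_comp (ZMod.finEquiv n).toEquiv]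
  refine Finset.sum_congr rfl fun i _ => ?_
  have : ((ZMod.finEquiv n) i : ZMod n) = ((i : ℕ) : ZMod n) := by
    obtain ⟨m, rfl⟩ : ∃ m, n = m + 1 := ⟨n - 1, (Nat.succ_pred_eq_of_ne_zero (NeZero.ne n)).symm⟩
    exact (Fin.cast_val_eq_self i).symm
  simp [this]

/-- Cyclic version of `IsExcessSeq`. -/
structure IsExcessCycle (α : ℝ) (h : ZMod n → ℝ) : Prop where
  nonneg : ∀ i, 0 ≤ h i
  recurrence : ∀ i, 0 < h (i + 1) →
    h i + 2 * Real.cos (2 * α) * h (i + 1) + h (i + 1 + 1) = 2 * (1 - Real.cos (2 * α))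

namespace IsExcessCycle

variable {α : ℝ} {h : ZMod n → ℝ}

theorem isExcessSeq (hh : IsExcessCycle α h) (a : ZMod n) :
    IsExcessSeq α fun k : ℕ => h (a + k) := by
  refine ⟨fun i => hh.nonneg _, fun i hi => ?_⟩
  have := hh.recurrence (a + i)
  simp only [Nat.cast_add, Nat.cast_one, Nat.cast_ofNat] at hi ⊢
  rw [← add_assoc] at hi
  have e : a + ((i : ZMod n) + 2) = a + i + 1 + 1 := by ring
  rw [e, ← add_assoc]
  exact this hi

variable [NeZero n]

/-- Adding the recurrence around the whole cycle forces the mean of h to be its constant solution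
tan² α. -/
theorem sum_eq_zero_of_forall_pos (hh : IsExcessCycle α h) (hc : Real.cos α ≠ 0)
    (hpos : ∀ i, 0 < h i) : ∑ i, (h i - Real.tan α ^ 2) = 0 := by
  have hT := tan_sq_mul_one_add_cos hc
  have h1 : ∑ i, (h i + 2 * Real.cos (2 * α) * h (i + 1) + h (i + 1 + 1)) =
      ∑ _i : ZMod n, 2 * (1 - Real.cos (2 * α)) :=
    Finset.sum_congr rfl fun i _ => hh.recurrence i (hpos _)
  have s1 : ∑ i, h (i + 1) = ∑ i, h i := Equiv.sum_comp (Equiv.addRight (1 : ZMod n)) h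
  have s2 : ∑ i, h (i + 1 + 1) = ∑ i, h i := by
    rw [← s1]; exact Equiv.sum_comp (Equiv.addRight (1 : ZMod n)) fun i => h (i + 1)
  rw [Finset.sum_add_distrib, Finset.sum_add_distrib, ← Finset.mul_sum, s1, s2] at h1
  rw [Finset.sum_sub_distrib]
  simp only [Finset.sum_const, Finset.card_univ, ZMod.card, nsmul_eq_mul] at h1 ⊢
  have hc2 : 1 + Real.cos (2 * α) ≠ 0 := by
    rw [Real.cos_two_mul]; intro h0; apply hc; nlinarith
  apply mul_right_cancel₀ hc2
  linear_combination h1 / 2 - n * hT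

theorem sum_le (hh : IsExcessCycle α h) (hα : n * α = Real.pi) (hα0 : 0 < α)
    (hα' : 2 * α < Real.pi / 2) :
    ∑ i, (h i - Real.tan α ^ 2) ≤ Real.tan α ^ 3 * (n / 2 * Real.tan (2 * α)) ∧
    (∑ i, (h i - Real.tan α ^ 2) = Real.tan α ^ 3 * (n / 2 * Real.tan (2 * α)) →
      ∃ a : ZMod n, ∀ j < n, h (a + (j : ℕ)) = 0 ↔ Even j) := by
  have hn : (0 : ℝ) < n := Nat.cast_pos.2 (NeZero.pos n)
  by_cases hz : ∃ a, h a = 0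
  · obtain ⟨a, ha⟩ := hz
    obtain ⟨i1, i2⟩ := IsExcessSeq.sum_le (m := n) hα0 hα' (hh.isExcessSeq a) hα.le
      (by simpa using ha) (by simpa using ha)
    rw [sum_zmod_eq_sum_range _ a]
    exact ⟨i1, fun he => ⟨a, (i2 he).2⟩⟩
  · push Not at hz
    have hc : 0 < Real.cos α := Real.cos_pos_of_mem_Ioo
      ⟨by linarith [Real.pi_pos], by linarith⟩
    rw [hh.sum_eq_zero_of_forall_pos hc.ne' fun i => (hh.nonneg i).lt_of_ne (hz i).symm]
    have ht : 0 < Real.tan α := Real.tan_pos_of_pos_of_lt_pi_div_two hα0 (by linarith)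
    have ht2 : 0 < Real.tan (2 * α) := Real.tan_pos_of_pos_of_lt_pi_div_two (by linarith) hα'
    have : 0 < Real.tan α ^ 3 * (n / 2 * Real.tan (2 * α)) := by positivity
    exact ⟨this.le, fun he => absurd he this.ne⟩

/-- Cut the cycle at the start of an odd gap of length l. That block has an exact sum, the remaining
n − l sides obey `IsExcessSeq.sum_le`, and together they give `oddValue` at l. -/
theorem sum_le_of_odd (hh : IsExcessCycle α h) (hα : n * α = Real.pi) (hα0 : 0 < α)
    (hα' : 2 * α < Real.pi / 2) (hn : 5 ≤ n) (hodd : Odd n)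
    {m : ℕ} (hm : Odd m) (hm1 : 2 * m < n) (hm2 : n < 2 * m + 4) :
    ∑ i, (h i - Real.tan α ^ 2) ≤ Real.tan α ^ 3 * oddValue α n m ∧
    (∑ i, (h i - Real.tan α ^ 2) = Real.tan α ^ 3 * oddValue α n m →
      ∃ a : ZMod n, ∀ j < n, h (a + (j : ℕ)) = 0 ↔ j = 0 ∨ m ≤ j ∧ Even (j - m)) := by
  have hn0 : (0 : ℝ) < n := Nat.cast_pos.2 (NeZero.pos n)
  have ht : 0 < Real.tan α := Real.tan_pos_of_pos_of_lt_pi_div_two hα0 (by linarith)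
  by_cases hz : ∃ a, h a = 0
  · obtain ⟨b, hb⟩ := hz
    obtain ⟨a', l, hal, hl, ha, hal0, hin⟩ := exists_odd_gap (H := fun k : ℕ => h (b + k)) hodd
      (by simpa using hb) (by simpa using hb)
    obtain ⟨a, rfl⟩ : ∃ a, b = a - (a' : ZMod n) := ⟨b + a', by ring⟩
    simp only [Nat.cast_add, ← add_assoc, sub_add_cancel] at ha hal0 hin
    have hs := hh.isExcessSeq a
    have hblock := hs.isBlock (l := l) hl.pos (by simpa using ha) hal0 hin
    have hln : (l : ℝ) ≤ n := by exact_mod_cast (by omega : l ≤ n)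
    have hlpi : l * α ≤ Real.pi := by rw [← hα]; nlinarith
    obtain ⟨s1, s2⟩ := hblock.sum_of_odd hα0 hα' hlpi hl
    have hcast : ((n - l : ℕ) : ℝ) = n - l := Nat.cast_sub (by omega)
    obtain ⟨i1, i2⟩ := IsExcessSeq.sum_le (m := n - l) hα0 hα' (hs.shift l)
      (by rw [hcast]; nlinarith [(Nat.cast_nonneg l : (0 : ℝ) ≤ l)])
      (by simpa using hal0)
      (by
        have e : l + (n - l) = n := by omega
        simp only [e, ZMod.natCast_self, add_zero]
        exact ha)
    rw [hcast] at i1 i2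
    have hsplit : ∑ i, (h i - Real.tan α ^ 2) =
        ∑ i ∈ Finset.range l, (h (a + (i : ℕ)) - Real.tan α ^ 2) +
        ∑ i ∈ Finset.range (n - l), (h (a + ((l + i : ℕ) : ZMod n)) - Real.tan α ^ 2) := by
      rw [sum_zmod_eq_sum_range _ a, ← Finset.sum_range_add
        (fun i : ℕ => h (a + i) - Real.tan α ^ 2), Nat.add_sub_cancel' (by omega)]
    have hval : Real.tan α ^ 3 * oddValue α n l = -Real.tan α ^ 3 *
        (Real.cos (l * α) / Real.sin (l * α)) +
        Real.tan α ^ 3 * (((n : ℝ) - l) / 2 * Real.tan (2 * α)) := by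
      unfold oddValue; ring
    have hle : ∑ i, (h i - Real.tan α ^ 2) ≤ Real.tan α ^ 3 * oddValue α n l := by
      rw [hsplit, s1, hval]
      linarith
    rcases eq_or_ne l m with rfl | hlm
    · refine ⟨hle, fun he => ⟨a, fun j hj => ?_⟩⟩
      rw [hsplit, s1, hval] at he
      obtain ⟨-, hpat⟩ := i2 (by linarith)
      rcases Nat.lt_or_ge j l with hjl | hjl
      · rcases Nat.eq_zero_or_pos j with rfl | hj0
        · simpa using ha
        · have := hin j hj0 hjl
          simp only [this, false_iff, not_or, not_and]
          exact ⟨by omega, by omega⟩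
      · have := hpat (j - l) (by omega)
        rw [Nat.add_sub_cancel' hjl] at this
        rw [this]
        have := hl.pos
        constructor
        · exact fun h => Or.inr ⟨hjl, h⟩
        · rintro (h | h)
          · omega
          · exact h.2
    -- This is the bound lα < π/2 + 2α, rewritten with nα = π.
    · have h2l : 2 * l < n + 4 := by
        have : (2 * (l : ℝ)) < n + 4 := by
          by_contra hcon
          push Not at hcon
          nlinarith
        exact_mod_cast this
      have hlt := mul_lt_mul_of_pos_left
        (oddValue_lt hα hα0 hα' hl hm hm1 hm2 h2l hlm) (pow_pos ht 3)
      exact ⟨by linarith, fun he => by linarith⟩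
  · push Not at hz
    have hc : 0 < Real.cos α := Real.cos_pos_of_mem_Ioo
      ⟨by linarith [Real.pi_pos], by linarith⟩
    rw [hh.sum_eq_zero_of_forall_pos hc.ne' fun i => (hh.nonneg i).lt_of_ne (hz i).symm]
    have := mul_pos (pow_pos ht 3) (oddValue_pos hα hα0 hα' hm hm1 hm2 hn)
    exact ⟨this.le, fun he => absurd he this.ne⟩

end IsExcessCycle

end cyclic

/-! ### The extremal sequence of excesses -/

/-- In the extremal polygons, side `j` is used if and only if it is the first side, or it has even
distance from side `m` in the part after the first block, which has `m` sides. -/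
def IsUsed (m j : ℕ) : Prop := j = 0 ∨ m ≤ j ∧ Even (j - m)

open Classical in
/-- The excesses of the extremal polygon that starts with a block of `m` sides and otherwise has
blocks of two sides. -/
def extremalSeq (α : ℝ) (m k : ℕ) : ℝ :=
  if k < m then
    Real.tan α ^ 2 * (1 + (-1) ^ k * (Real.sin ((2 * k - m) * α) / Real.sin (m * α)))
  else if Even (k - m) then 0 else (1 - Real.cos (2 * α)) / Real.cos (2 * α)

section extremalSeq

variable {α : ℝ} {m n : ℕ}

/-- The trigonometric formula also holds at k = m, where it gives 0; hence the recurrence can be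
checked up to the end of the first block. -/
theorem extremalSeq_of_le (hm : Odd m) (hs : Real.sin (m * α) ≠ 0) {k : ℕ} (hk : k ≤ m) :
    extremalSeq α m k =
      Real.tan α ^ 2 * (1 + (-1) ^ k * (Real.sin ((2 * k - m) * α) / Real.sin (m * α))) := by
  unfold extremalSeq
  rcases hk.lt_or_eq with h | rfl
  · rw [if_pos h]
  · have e : (2 * (k : ℝ) - k) * α = k * α := by ring
    rw [if_neg (lt_irrefl _), Nat.sub_self, if_pos (by simp), e, div_self hs, hm.neg_one_pow]
    ring

/-- Since mα < π/2 and |2k − m| < m, monotonicity of the sine puts the quotient strictly between −1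
and 1. This is where 2m < n matters. -/
theorem extremalSeq_pos_of_lt (hα : n * α = Real.pi) (hα0 : 0 < α) (hα' : 2 * α < Real.pi / 2)
    (hm1 : 2 * m < n) {k : ℕ} (hk0 : 0 < k) (hk : k < m) : 0 < extremalSeq α m k := by
  have h1 : 2 * (m : ℝ) < n := by exact_mod_cast hm1
  have h2 : (k : ℝ) < m := by exact_mod_cast hk
  have h3 : (0 : ℝ) < k := by exact_mod_cast hk0
  have h4 : m * α < Real.pi / 2 := by nlinarith
  have ht : 0 < Real.tan α := Real.tan_pos_of_pos_of_lt_pi_div_two hα0 (by linarith)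
  have hka : 0 < k * α := by positivity
  have hkm : k * α < m * α := by nlinarith
  have hs : 0 < Real.sin (m * α) := Real.sin_pos_of_pos_of_lt_pi (by linarith) (by linarith)
  have u : Real.sin ((2 * k - m) * α) < Real.sin (m * α) :=
    Real.strictMonoOn_sin ⟨by nlinarith, by nlinarith⟩ ⟨by linarith, by linarith⟩ (by nlinarith)
  have v : - Real.sin (m * α) < Real.sin ((2 * k - m) * α) := by
    rw [← Real.sin_neg]
    exact Real.strictMonoOn_sin ⟨by linarith, by linarith⟩ ⟨by nlinarith, by nlinarith⟩
      (by nlinarith)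
  unfold extremalSeq
  rw [if_pos hk]
  apply mul_pos (by positivity)
  have u' : Real.sin ((2 * k - m) * α) / Real.sin (m * α) < 1 := (div_lt_one hs).2 u
  have v' : -1 < Real.sin ((2 * k - m) * α) / Real.sin (m * α) := by
    rw [lt_div_iff₀ hs]; linarith
  rcases neg_one_pow_eq_or ℝ k with e | e <;> rw [e] <;> linarith

theorem extremalSeq_recurrence (hα : n * α = Real.pi) (hα0 : 0 < α) (hα' : 2 * α < Real.pi / 2)
    (hm : m = 0 ∨ Odd m) (hm1 : 2 * m < n) (k : ℕ) (hk : 0 < extremalSeq α m (k + 1)) :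
    extremalSeq α m k + 2 * Real.cos (2 * α) * extremalSeq α m (k + 1) + extremalSeq α m (k + 2) =
      2 * (1 - Real.cos (2 * α)) := by
  have hpi := Real.pi_pos
  have hc : 0 < Real.cos α := Real.cos_pos_of_mem_Ioo ⟨by linarith, by linarith⟩
  have hc2 : 0 < Real.cos (2 * α) := Real.cos_pos_of_mem_Ioo ⟨by linarith, by linarith⟩
  have hT := tan_sq_mul_one_add_cos hc.ne'
  rcases Nat.lt_or_ge (k + 1) m with h | h
  · have hmodd : Odd m := by
      rcases hm with rfl | hm
      · omega
      · exact hm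
    have h1 : 2 * (m : ℝ) < n := by exact_mod_cast hm1
    have h0 : (0 : ℝ) < m := by exact_mod_cast hmodd.pos
    have hs : 0 < Real.sin (m * α) :=
      Real.sin_pos_of_pos_of_lt_pi (by positivity) (by nlinarith)
    rw [extremalSeq_of_le hmodd hs.ne' h.le, extremalSeq_of_le hmodd hs.ne' (k := k) (by omega),
      extremalSeq_of_le hmodd hs.ne' (k := k + 2) (by omega)]
    have e0 : (2 * (k : ℝ) - m) * α = (2 * ((k + 1 : ℕ) : ℝ) - m) * α - 2 * α := by
      push_cast; ring
    have e2 : (2 * ((k + 2 : ℕ) : ℝ) - m) * α = (2 * ((k + 1 : ℕ) : ℝ) - m) * α + 2 * α := by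
      push_cast; ring
    rw [e0, e2, Real.sin_sub, Real.sin_add, pow_succ, pow_add]
    linear_combination 2 * hT
  · have hodd : ¬ Even (k + 1 - m) := by
      intro he
      unfold extremalSeq at hk
      rw [if_neg (by omega), if_pos he] at hk
      exact lt_irrefl _ hk
    have hkm : m ≤ k := by
      by_contra hlt
      apply hodd
      have : k + 1 - m = 0 := by omega
      rw [this]; simp
    unfold extremalSeq
    have e1 : k + 1 - m = k - m + 1 := by omega
    have e2 : k + 2 - m = k - m + 1 + 1 := by omega
    rw [e1, Nat.not_even_iff_odd] at hodd
    have hev : Even (k - m) := by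
      rw [Nat.odd_add_one, Nat.not_odd_iff_even] at hodd; exact hodd
    rw [if_neg (show ¬ k < m by omega), if_pos hev, if_neg (show ¬ k + 1 < m by omega), e1,
      if_neg (Nat.not_even_iff_odd.2 hodd), if_neg (show ¬ k + 2 < m by omega), e2,
      if_pos hodd.add_one]
    field_simp
    ring

theorem extremalSeq_eq_zero_iff (hα : n * α = Real.pi) (hα0 : 0 < α) (hα' : 2 * α < Real.pi / 2)
    (hm : m = 0 ∨ Odd m) (hm1 : 2 * m < n) (k : ℕ) :
    extremalSeq α m k = 0 ↔ IsUsed m k := by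
  have hpi := Real.pi_pos
  have hc2 : 0 < Real.cos (2 * α) := Real.cos_pos_of_mem_Ioo ⟨by linarith, by linarith⟩
  have hc2' : Real.cos (2 * α) < 1 := by
    rw [← Real.cos_zero]
    exact Real.cos_lt_cos_of_nonneg_of_le_pi_div_two le_rfl hα'.le (by linarith)
  unfold IsUsed
  rcases Nat.lt_or_ge k m with h | h
  · rcases Nat.eq_zero_or_pos k with rfl | hk
    · have hmodd : Odd m := by
        rcases hm with rfl | hm
        · omega
        · exact hm
      have h1 : 2 * (m : ℝ) < n := by exact_mod_cast hm1
      have h0 : (0 : ℝ) < m := by exact_mod_cast hmodd.pos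
      have hs : 0 < Real.sin (m * α) :=
        Real.sin_pos_of_pos_of_lt_pi (by positivity) (by nlinarith)
      rw [extremalSeq_of_le hmodd hs.ne' h.le]
      have e : (2 * ((0 : ℕ) : ℝ) - m) * α = - (m * α) := by push_cast; ring
      rw [e, Real.sin_neg, neg_div, div_self hs.ne']
      simp
    · have := (extremalSeq_pos_of_lt hα hα0 hα' hm1 hk h).ne'
      simp only [this, false_iff]
      omega
  · unfold extremalSeq
    rw [if_neg (by omega)]
    have hpos : (1 - Real.cos (2 * α)) / Real.cos (2 * α) ≠ 0 :=
      (div_pos (by linarith) hc2).ne'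
    split_ifs with he
    · simp [h, he]
    · simp only [hpos, he, and_false, or_false, false_iff]
      rintro rfl
      apply he
      simp

theorem extremalSeq_nonneg (hα : n * α = Real.pi) (hα0 : 0 < α) (hα' : 2 * α < Real.pi / 2)
    (hm : m = 0 ∨ Odd m) (hm1 : 2 * m < n) (k : ℕ) : 0 ≤ extremalSeq α m k := by
  have hpi := Real.pi_pos
  have hc2 : 0 < Real.cos (2 * α) := Real.cos_pos_of_mem_Ioo ⟨by linarith, by linarith⟩
  rcases Nat.lt_or_ge k m with h | h
  · rcases Nat.eq_zero_or_pos k with rfl | hk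
    · exact ((extremalSeq_eq_zero_iff hα hα0 hα' hm hm1 0).2 (Or.inl rfl)).ge
    · exact (extremalSeq_pos_of_lt hα hα0 hα' hm1 hk h).le
  · unfold extremalSeq
    rw [if_neg (by omega)]
    split_ifs
    · exact le_rfl
    · exact div_nonneg (by linarith [Real.cos_le_one (2 * α)]) hc2.le

theorem sum_extremalSeq_tail (hα0 : 0 < α) (hα' : 2 * α < Real.pi / 2) (q : ℕ) :
    ∑ i ∈ Finset.range (2 * q), (extremalSeq α m (m + i) - Real.tan α ^ 2) =
      Real.tan α ^ 3 * (q * Real.tan (2 * α)) := by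
  have hpi := Real.pi_pos
  have hc : 0 < Real.cos α := Real.cos_pos_of_mem_Ioo ⟨by linarith, by linarith⟩
  have hc2 : 0 < Real.cos (2 * α) := Real.cos_pos_of_mem_Ioo ⟨by linarith, by linarith⟩
  have hT := tan_sq_mul_one_add_cos hc.ne'
  have hT' := tan_mul_one_add_cos hc.ne'
  induction q with
  | zero => simp
  | succ q ih =>
    rw [show 2 * (q + 1) = 2 * q + 1 + 1 by ring, Finset.sum_range_succ, Finset.sum_range_succ, ih]
    have h0 : extremalSeq α m (m + 2 * q) = 0 := by
      unfold extremalSeq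
      rw [if_neg (by omega), Nat.add_sub_cancel_left, if_pos (even_two_mul q)]
    have h1 : extremalSeq α m (m + (2 * q + 1)) =
        (1 - Real.cos (2 * α)) / Real.cos (2 * α) := by
      unfold extremalSeq
      rw [if_neg (by omega), Nat.add_sub_cancel_left, if_neg (by simp)]
    have h2 : (1 - Real.cos (2 * α)) / Real.cos (2 * α) - 2 * Real.tan α ^ 2 =
        Real.tan α ^ 3 * Real.tan (2 * α) := by
      rw [Real.tan_eq_sin_div_cos (2 * α), ← hT', ← hT]
      field_simp
      linear_combination - Real.tan α ^ 2 * hT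
    rw [h0, h1]
    push_cast
    linear_combination h2

/-- The optimal value of the total excess, for an extremal polygon with first block of `m` sides. -/
def extremalValue (α : ℝ) (n m : ℕ) : ℝ :=
  if m = 0 then n / 2 * Real.tan (2 * α) else oddValue α n m

theorem sum_extremalSeq (hα : n * α = Real.pi) (hα0 : 0 < α) (hα' : 2 * α < Real.pi / 2)
    (hm : m = 0 ∨ Odd m) (hm1 : 2 * m < n) (hev : Even (n - m)) :
    ∑ i ∈ Finset.range n, (extremalSeq α m i - Real.tan α ^ 2) =
      Real.tan α ^ 3 * extremalValue α n m := by
  obtain ⟨q, hq⟩ := hev.two_dvd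
  have hnm : n = m + 2 * q := by omega
  rw [hnm, Finset.sum_range_add, sum_extremalSeq_tail hα0 hα', ← hnm]
  have hn : (n : ℝ) = m + 2 * q := by exact_mod_cast hnm
  unfold extremalValue
  rcases hm with rfl | hm
  · rw [if_pos rfl, hn]; simp
  · have hb : IsBlock α m (extremalSeq α m) := by
      have hz := extremalSeq_eq_zero_iff hα hα0 hα' (Or.inr hm) hm1
      refine ⟨hm.pos, (hz 0).2 (Or.inl rfl), (hz m).2 (Or.inr ⟨le_rfl, by simp⟩),
        fun i => extremalSeq_pos_of_lt hα hα0 hα' hm1, fun i hi =>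
        extremalSeq_recurrence hα hα0 hα' (Or.inr hm) hm1 i
          (extremalSeq_pos_of_lt hα hα0 hα' hm1 (by omega) hi)⟩
    have h1 : 2 * (m : ℝ) < n := by exact_mod_cast hm1
    rw [if_neg (by have := hm.pos; omega),
      (hb.sum_of_odd hα0 hα' (by nlinarith [(Nat.cast_nonneg m : (0 : ℝ) ≤ m)]) hm).1]
    unfold oddValue
    rw [hn]
    ring

end extremalSeq

/-! ### The optimum of the total excess -/

section optimum

variable {n : ℕ} [NeZero n]

/-- A choice of slopes of the supporting lines at the vertices. -/
def Slopes (z : ZMod n → ℝ) : Prop := ∀ i, z i ∈ Set.Icc (-1 : ℝ) 1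

/-- The excess over the side `i`. -/
def sideExcess (M : ℝ) (z : ZMod n → ℝ) (i : ZMod n) : ℝ :=
  excess (M * (1 - z i)) (M * (1 + z (i + 1)))

/-- The total excess is at most `V`, with equality only for the pattern of used sides with first
block of length `m`, which occurs. -/
structure IsOptimum (n : ℕ) [NeZero n] (M V : ℝ) (m : ℕ) : Prop where
  le : ∀ z : ZMod n → ℝ, Slopes z → totalExcess M z ≤ V
  pattern : ∀ z : ZMod n → ℝ, Slopes z → totalExcess M z = V →
    ∃ a : ZMod n, ∀ j < n, sideExcess M z (a + (j : ℕ)) = 0 ↔ IsUsed m j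
  attained : ∃ z : ZMod n → ℝ, Slopes z ∧ totalExcess M z = V ∧
    ∀ j < n, sideExcess M z (j : ℕ) = 0 ↔ IsUsed m j

theorem val_add_one_eq_ite (hn : 2 ≤ n) (i : ZMod n) :
    (i + 1).val = if i.val + 1 = n then 0 else i.val + 1 := by
  have : Fact (1 < n) := ⟨hn⟩
  have hi := ZMod.val_lt i
  rw [ZMod.val_add, ZMod.val_one]
  split_ifs with h
  · rw [h, Nat.mod_self]
  · exact Nat.mod_eq_of_lt (by omega)

theorem exists_slopes_extremalSeq {α : ℝ} {m : ℕ} (hn : 5 ≤ n)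
    (hα : n * α = Real.pi) (hα0 : 0 < α) (hα' : 2 * α < Real.pi / 2)
    (hm : m = 0 ∨ Odd m) (hm1 : 2 * m < n) (hev : Even (n - m)) :
    ∃ z : ZMod n → ℝ, Slopes z ∧
      ∀ i, sideExcess (1 - Real.cos (2 * α)) z i = extremalSeq α m i.val := by
  have hz := extremalSeq_eq_zero_iff hα hα0 hα' hm hm1
  have hnn := extremalSeq_nonneg hα hα0 hα' hm hm1
  have hpos : ∀ k, ¬ IsUsed m k → 0 < extremalSeq α m k := fun k hk =>
    (hnn k).lt_of_ne fun h => hk ((hz k).1 h.symm)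
  -- As n − m is even, position n is a zero like position 0, so the linear sequence closes up to a
  -- cycle.
  have hn0 : extremalSeq α m n = 0 := (hz n).2 (Or.inr ⟨by omega, hev⟩)
  have h00 : extremalSeq α m 0 = 0 := (hz 0).2 (Or.inl rfl)
  have hc2' : Real.cos (2 * α) < 1 := by
    rw [← Real.cos_zero]
    exact Real.cos_lt_cos_of_nonneg_of_le_pi_div_two le_rfl hα'.le (by linarith)
  have hval : ∀ i : ZMod n, i.val + 1 < n →
      extremalSeq α m (i + 1 + 1).val = extremalSeq α m (i.val + 2) := by
    intro i hi
    have h1 := val_add_one_eq_ite (by omega) i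
    rw [if_neg (by omega)] at h1
    rw [val_add_one_eq_ite (by omega) (i + 1), h1]
    split_ifs with h2
    · exact h00.trans ((congrArg (extremalSeq α m) h2).trans hn0).symm
    · rfl
  refine exists_excess_eq (h := fun i => extremalSeq α m i.val) (by linarith) (fun i => hnn _)
    (fun i hi => ?_) (fun i hi => ?_)
  · have h1 := val_add_one_eq_ite (by omega) i
    split_ifs at h1 with h2
    · rw [h1, h00] at hi
      exact absurd hi (lt_irrefl _)
    · have := ZMod.val_lt i
      rw [hval i (by omega), h1]
      rw [h1] at hi
      have := extremalSeq_recurrence hα hα0 hα' hm hm1 _ hi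
      linear_combination this
  · have h1 := val_add_one_eq_ite (by omega) i
    have hlt := ZMod.val_lt i
    split_ifs at h1 with h2
    · left
      apply hpos
      unfold IsUsed
      rintro (h | ⟨-, h⟩)
      · omega
      · obtain ⟨x, hx⟩ := hev
        obtain ⟨y, hy⟩ := h
        omega
    · right
      simp only [h1] at hi
      have hi' := (hz _).1 hi
      rw [hval i (by omega)]
      apply hpos
      unfold IsUsed at hi' ⊢
      rintro (h | ⟨-, h⟩)
      · omega
      · rcases hi' with hi' | ⟨h3, h4⟩
        · omega
        · obtain ⟨x, hx⟩ := h4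
          obtain ⟨y, hy⟩ := h
          omega

theorem isExcessCycle_of_isMax (hn : 2 ≤ n) {α : ℝ} (hα0 : 0 < α) (hα' : 2 * α < Real.pi / 2)
    {z : ZMod n → ℝ} (hz : Slopes z)
    (hmax : ∀ w : ZMod n → ℝ, Slopes w →
      totalExcess (1 - Real.cos (2 * α)) w ≤ totalExcess (1 - Real.cos (2 * α)) z) :
    IsExcessCycle α (sideExcess (1 - Real.cos (2 * α)) z) := by
  have hpi := Real.pi_pos
  have hc2 : 0 < Real.cos (2 * α) := Real.cos_pos_of_mem_Ioo ⟨by linarith, by linarith⟩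
  have hc2' : Real.cos (2 * α) < 1 := by
    rw [← Real.cos_zero]
    exact Real.cos_lt_cos_of_nonneg_of_le_pi_div_two le_rfl hα'.le (by linarith)
  have b := fun j => slope_mem_Icc (M := 1 - Real.cos (2 * α)) (by linarith) (hz j)
  refine ⟨fun i => ?_, fun i hi => ?_⟩
  · exact excess_nonneg (by linarith) (b _).1 (b _).2.2.1 (b _).2.1 (b _).2.2.2
  · have := recurrence_of_isMax hn (by linarith) (by linarith) hz hmax i hi
    unfold sideExcess
    linear_combination this

/-- A maximizer exists and its excesses form an `IsExcessCycle`, so a bound for such cycles bounds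
all choices of slopes. A choice attaining the bound is itself a maximizer and inherits the pattern.
-/
theorem isOptimum_of_cycle {α : ℝ} {m : ℕ} (hn : 5 ≤ n)
    (hα : n * α = Real.pi) (hα0 : 0 < α) (hα' : 2 * α < Real.pi / 2)
    (hm : m = 0 ∨ Odd m) (hm1 : 2 * m < n) (hev : Even (n - m))
    (hle : ∀ h : ZMod n → ℝ, IsExcessCycle α h →
      ∑ i, (h i - Real.tan α ^ 2) ≤ Real.tan α ^ 3 * extremalValue α n m ∧
      (∑ i, (h i - Real.tan α ^ 2) = Real.tan α ^ 3 * extremalValue α n m →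
        ∃ a : ZMod n, ∀ j < n, h (a + (j : ℕ)) = 0 ↔ IsUsed m j)) :
    IsOptimum n (1 - Real.cos (2 * α))
      (n * Real.tan α ^ 2 + Real.tan α ^ 3 * extremalValue α n m) m := by
  have hpi := Real.pi_pos
  have hc2 : 0 < Real.cos (2 * α) := Real.cos_pos_of_mem_Ioo ⟨by linarith, by linarith⟩
  have hsum : ∀ z : ZMod n → ℝ, ∑ i, (sideExcess (1 - Real.cos (2 * α)) z i - Real.tan α ^ 2) =
      totalExcess (1 - Real.cos (2 * α)) z - n * Real.tan α ^ 2 := by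
    intro z
    rw [Finset.sum_sub_distrib]
    simp [totalExcess, sideExcess, ZMod.card]
  have hmaxle : ∀ z : ZMod n → ℝ, Slopes z → totalExcess (1 - Real.cos (2 * α)) z ≤
      n * Real.tan α ^ 2 + Real.tan α ^ 3 * extremalValue α n m := by
    obtain ⟨z, hz, hmax⟩ := exists_isMaxOn_totalExcess (n := n) (M := 1 - Real.cos (2 * α))
      (by linarith [Real.cos_le_one (2 * α)]) (by linarith)
    have h1 := (hle _ (isExcessCycle_of_isMax (by omega) hα0 hα' hz hmax)).1
    rw [hsum] at h1
    intro w hw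
    linarith [hmax w hw]
  refine ⟨hmaxle, fun z hz he => ?_, ?_⟩
  · refine (hle _ (isExcessCycle_of_isMax (by omega) hα0 hα' hz
      fun w hw => (hmaxle w hw).trans he.ge)).2 ?_
    rw [hsum, he]; ring
  · obtain ⟨z, hz, hzi⟩ := exists_slopes_extremalSeq hn hα hα0 hα' hm hm1 hev
    refine ⟨z, hz, ?_, fun j hj => ?_⟩
    · have h1 := hsum z
      rw [sum_zmod_eq_sum_range _ 0] at h1
      have h2 := sum_extremalSeq hα hα0 hα' hm hm1 hev
      rw [Finset.sum_congr rfl (g := fun i => extremalSeq α m i - Real.tan α ^ 2)] at h1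
      · linarith
      · intro k hk
        rw [hzi, zero_add, ZMod.val_natCast_of_lt (Finset.mem_range.1 hk)]
    · rw [hzi, ZMod.val_natCast_of_lt hj]
      exact extremalSeq_eq_zero_iff hα hα0 hα' hm hm1 j

theorem isOptimum_of_even {α : ℝ} (hn : 5 ≤ n)
    (hα : n * α = Real.pi) (hα0 : 0 < α) (hα' : 2 * α < Real.pi / 2) (hev : Even n) :
    IsOptimum n (1 - Real.cos (2 * α))
      (n * Real.tan α ^ 2 + Real.tan α ^ 3 * (n / 2 * Real.tan (2 * α))) 0 := by
  have hu : ∀ j, IsUsed 0 j ↔ Even j := by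
    intro j
    unfold IsUsed
    constructor
    · rintro (rfl | h)
      · simp
      · simpa using h.2
    · intro h
      right; simpa using h
  have := isOptimum_of_cycle (m := 0) hn hα hα0 hα' (Or.inl rfl) (by omega) (by simpa using hev)
  simp only [extremalValue, if_true, hu] at this
  exact this fun h hh => hh.sum_le hα hα0 hα'

theorem isOptimum_of_odd {α : ℝ} {m : ℕ} (hn : 5 ≤ n)
    (hα : n * α = Real.pi) (hα0 : 0 < α) (hα' : 2 * α < Real.pi / 2) (hodd : Odd n)
    (hm : Odd m) (hm1 : 2 * m < n) (hm2 : n < 2 * m + 4) :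
    IsOptimum n (1 - Real.cos (2 * α))
      (n * Real.tan α ^ 2 + Real.tan α ^ 3 * oddValue α n m) m := by
  have := isOptimum_of_cycle (m := m) hn hα hα0 hα' (Or.inr hm) hm1 (Nat.Odd.sub_odd hodd hm)
  rw [extremalValue, if_neg (by have := hm.pos; omega)] at this
  exact this fun h hh => hh.sum_le_of_odd hα hα0 hα' hn hodd hm hm1 hm2

end optimum

/-! ### Supporting functionals -/

section support

theorem mem_frontier_of_forall_le {E : Type*} [NormedAddCommGroup E] [NormedSpace ℝ E] {Q : Set E}
    {x v : E} (f : E →L[ℝ] ℝ) (hx : x ∈ Q) (hf : ∀ y ∈ Q, f y ≤ f x) (hv : 0 < f v) :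
    x ∈ frontier Q := by
  refine ⟨subset_closure hx, fun hint => ?_⟩
  have hc : Filter.Tendsto (fun ε : ℝ => x + ε • v) (nhdsWithin 0 (Set.Ioi 0)) (nhds x) := by
    have : Continuous fun ε : ℝ => x + ε • v := by fun_prop
    simpa using (this.tendsto 0).mono_left (nhdsWithin_le_nhds (s := Set.Ioi 0))
  have h1 := hc.eventually (mem_interior_iff_mem_nhds.1 hint)
  obtain ⟨ε, h2, h3⟩ := (h1.and self_mem_nhdsWithin).exists
  have h4 := hf _ h2
  rw [map_add, map_smul, smul_eq_mul] at h4
  have := mul_pos (Set.mem_Ioi.1 h3) hv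
  linarith

theorem exists_support {Q : Set Plane} (hQ : Convex ℝ Q) (hint : (interior Q).Nonempty) {x : Plane}
    (hx : x ∈ frontier Q) :
    ∃ f : Plane →L[ℝ] ℝ, f ≠ 0 ∧ ∀ y ∈ Q, f y ≤ f x := by
  obtain ⟨f, hf⟩ := geometric_hahn_banach_open_point hQ.interior isOpen_interior hx.2
  refine ⟨f, ?_, fun y hy => ?_⟩
  · rintro rfl
    obtain ⟨y, hy⟩ := hint
    simpa using hf y hy
  · have hcl : y ∈ closure (interior Q) := by
      rw [hQ.closure_interior_eq_closure_of_nonempty_interior hint]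
      exact subset_closure hy
    exact closure_minimal (fun z hz => (hf z hz).le)
      (isClosed_le f.continuous continuous_const) hcl

end support

/-! ### Areas of triangles -/

section triangle

/-- The closed standard triangle. -/
def stdTriangle : Set Plane := {w | 0 ≤ w 0 ∧ 0 ≤ w 1 ∧ w 0 + w 1 ≤ 1}

/-- The open standard triangle. -/
def openStdTriangle : Set Plane := {w | 0 < w 0 ∧ 0 < w 1 ∧ w 0 + w 1 < 1}

theorem volume_openStdTriangle : volume openStdTriangle = ENNReal.ofReal (1 / 2) := by
  have h1 := (PiLp.volume_preserving_toLp (Fin 2)).comp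
    (volume_preserving_finTwoArrow ℝ).symm
  have hopen : IsOpen openStdTriangle := by
    have c0 : Continuous fun w : Plane => w 0 := by fun_prop
    have c1 : Continuous fun w : Plane => w 1 := by fun_prop
    exact (isOpen_lt continuous_const c0).inter
      ((isOpen_lt continuous_const c1).inter (isOpen_lt (c0.add c1) continuous_const))
  rw [← h1.measure_preimage hopen.measurableSet.nullMeasurableSet]
  have h2 : (WithLp.toLp 2 ∘ (MeasurableEquiv.finTwoArrow (α := ℝ)).symm) ⁻¹' openStdTriangle =
      regionBetween (fun _ => (0 : ℝ)) (fun x => 1 - x) (Set.Ioo 0 1) := by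
    ext ⟨x, y⟩
    simp only [openStdTriangle, regionBetween, Set.mem_preimage, Set.mem_ofPred_eq, Set.mem_Ioo,
      Function.comp]
    change 0 < x ∧ 0 < y ∧ x + y < 1 ↔ _
    constructor
    · rintro ⟨a, b, c⟩
      exact ⟨⟨a, by linarith⟩, b, by linarith⟩
    · rintro ⟨⟨a, b⟩, c, d⟩
      exact ⟨a, c, by linarith⟩
  rw [h2, Measure.volume_eq_prod, volume_regionBetween_eq_integral]
  · congr 1
    simp only [Pi.sub_apply, sub_zero]
    rw [← integral_Ioc_eq_integral_Ioo, ← intervalIntegral.integral_of_le zero_le_one]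
    rw [intervalIntegral.integral_sub (by simp) (by simp)]
    norm_num
  · exact integrableOn_zero
  · exact (Continuous.integrableOn_Icc (by fun_prop)).mono_set Set.Ioo_subset_Icc_self
  · exact measurableSet_Ioo
  · intro x hx
    exact (sub_pos.2 hx.2).le

/-- The closed triangle adds only frontier points, and the frontier of a convex set is null. Closed
triangles serve for covering (upper bounds), open ones for packing (lower bounds). -/
theorem volume_stdTriangle_le : volume stdTriangle ≤ ENNReal.ofReal (1 / 2) := by
  have hconv : Convex ℝ stdTriangle := by
    rintro x ⟨a, b, c⟩ y ⟨a', b', c'⟩ s t hs ht hst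
    simp only [stdTriangle, Set.mem_ofPred_eq, PiLp.add_apply, PiLp.smul_apply, smul_eq_mul]
    refine ⟨by positivity, by positivity, ?_⟩
    nlinarith
  have hsub : stdTriangle ⊆ openStdTriangle ∪ frontier stdTriangle := by
    intro w hw
    by_cases ho : w ∈ openStdTriangle
    · exact Or.inl ho
    · right
      let e0 : Plane →L[ℝ] ℝ := EuclideanSpace.proj 0
      let e1 : Plane →L[ℝ] ℝ := EuclideanSpace.proj 1
      have E0 : ∀ y, e0 y = y 0 := fun _ => rfl
      have E1 : ∀ y, e1 y = y 1 := fun _ => rfl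
      obtain ⟨a, b, c⟩ := hw
      rcases a.lt_or_eq with a' | a'
      · rcases b.lt_or_eq with b' | b'
        · have c' : w 0 + w 1 = 1 := by
            by_contra hc
            exact ho ⟨a', b', lt_of_le_of_ne c hc⟩
          refine mem_frontier_of_forall_le (e0 + e1) (v := !₂[1, 1]) ⟨a, b, c⟩ ?_ ?_
          · intro y hy
            simpa [E0, E1, c'] using hy.2.2
          · simp [E0, E1]
        · refine mem_frontier_of_forall_le (-e1) (v := !₂[0, -1]) ⟨a, b, c⟩ ?_ ?_
          · intro y hy
            simpa [E1, ← b'] using hy.2.1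
          · simp [E1]
      · refine mem_frontier_of_forall_le (-e0) (v := !₂[-1, 0]) ⟨a, b, c⟩ ?_ ?_
        · intro y hy
          simpa [E0, ← a'] using hy.1
        · simp [E0]
  calc volume stdTriangle ≤ volume (openStdTriangle ∪ frontier stdTriangle) := measure_mono hsub
    _ ≤ volume openStdTriangle + volume (frontier stdTriangle) := measure_union_le _ _
    _ = _ := by rw [hconv.addHaar_frontier volume, add_zero, volume_openStdTriangle]

/-- The linear map sending the standard basis to `a`, `b`. -/
def triMap (a b : Plane) : Plane →ₗ[ℝ] Plane where
  toFun w := w 0 • a + w 1 • b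
  map_add' x y := by simp only [PiLp.add_apply]; module
  map_smul' r x := by simp only [PiLp.smul_apply, smul_eq_mul, RingHom.id_apply]; module

theorem triMap_apply (a b w : Plane) : triMap a b w = w 0 • a + w 1 • b := rfl

/-- The determinant of two plane vectors. -/
def cross (a b : Plane) : ℝ := a 0 * b 1 - a 1 * b 0

theorem det_triMap (a b : Plane) : LinearMap.det (triMap a b) = cross a b := by
  rw [← LinearMap.det_toMatrix (EuclideanSpace.basisFun (Fin 2) ℝ).toBasis, Matrix.det_fin_two]
  simp [LinearMap.toMatrix_apply, triMap_apply, cross]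
  ring

theorem volume_triangle_le (a b : Plane) :
    volume (triMap a b '' stdTriangle) ≤ ENNReal.ofReal (|cross a b| / 2) := by
  rw [Measure.addHaar_image_linearMap, det_triMap, div_eq_mul_one_div,
    ENNReal.ofReal_mul (abs_nonneg _)]
  gcongr
  exact volume_stdTriangle_le

theorem volume_openTriangle (a b : Plane) :
    volume (triMap a b '' openStdTriangle) = ENNReal.ofReal (|cross a b| / 2) := by
  rw [Measure.addHaar_image_linearMap, det_triMap, div_eq_mul_one_div,
    ENNReal.ofReal_mul (abs_nonneg _), volume_openStdTriangle]

end triangle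

/-! ### Polar coordinates and linear functionals -/

section circle

/-- The point of the unit circle with polar angle `x`. -/
def circ (x : ℝ) : Plane := !₂[Real.cos x, Real.sin x]

@[simp] theorem circ_zero_coord (x : ℝ) : circ x 0 = Real.cos x := rfl

@[simp] theorem circ_one_coord (x : ℝ) : circ x 1 = Real.sin x := rfl

theorem plane_ext {x y : Plane} (h0 : x 0 = y 0) (h1 : x 1 = y 1) : x = y := by
  ext i; fin_cases i
  · exact h0
  · exact h1

theorem circ_add (x y : ℝ) :
    circ (x + y) = Real.cos y • circ x + Real.sin y • circ (x + Real.pi / 2) := by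
  apply plane_ext
  · simp [Real.cos_add]; ring
  · simp [Real.sin_add]; ring

theorem circ_add_congr {x x' : ℝ} (h : circ x = circ x') (y : ℝ) :
    circ (x + y) = circ (x' + y) := by
  have h0 : Real.cos x = Real.cos x' := congrArg (fun w : Plane => w 0) h
  have h1 : Real.sin x = Real.sin x' := congrArg (fun w : Plane => w 1) h
  apply plane_ext
  · simp [Real.cos_add, h0, h1]
  · simp [Real.sin_add, h0, h1]

theorem exists_polar (w : Plane) : ∃ r x : ℝ, 0 ≤ r ∧ w = r • circ x := by
  refine ⟨‖(⟨w 0, w 1⟩ : ℂ)‖, Complex.arg ⟨w 0, w 1⟩, norm_nonneg _, plane_ext ?_ ?_⟩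
  · simp [Complex.norm_mul_cos_arg]
  · simp [Complex.norm_mul_sin_arg]

theorem cross_circ (x y : ℝ) : cross (circ x) (circ (x + y)) = Real.sin y := by
  simp only [cross, circ_zero_coord, circ_one_coord, Real.cos_add, Real.sin_add]
  linear_combination Real.sin y * Real.sin_sq_add_cos_sq x

theorem cross_add_right (a b c : Plane) (u v : ℝ) :
    cross a (u • b + v • c) = u * cross a b + v * cross a c := by
  simp [cross]; ring

theorem cross_add_left (a b c : Plane) (u v : ℝ) :
    cross (u • b + v • c) a = u * cross b a + v * cross c a := by
  simp [cross]; ring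

@[simp] theorem cross_self (a : Plane) : cross a a = 0 := by simp [cross]; ring

theorem circ_add_eq_combination {α : ℝ} (hs : Real.sin (2 * α) ≠ 0) (x y : ℝ) :
    circ (x + y) = (Real.sin (2 * α - y) / Real.sin (2 * α)) • circ x +
      (Real.sin y / Real.sin (2 * α)) • circ (x + 2 * α) := by
  apply plane_ext
  · simp only [PiLp.add_apply, PiLp.smul_apply, circ_zero_coord, smul_eq_mul, Real.cos_add,
      Real.sin_sub]
    field_simp
    ring
  · simp only [PiLp.add_apply, PiLp.smul_apply, circ_one_coord, smul_eq_mul, Real.sin_add,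
      Real.sin_sub]
    field_simp
    ring

/-- Points in the open cone between two rays have a polar angle between those of the rays. -/
theorem exists_polar_of_cone {α : ℝ} (hα0 : 0 < α) (hα' : 2 * α < Real.pi / 2) {u v : ℝ}
    (hu : 0 < u) (hv : 0 < v) (x : ℝ) :
    ∃ r y : ℝ, 0 < r ∧ 0 < y ∧ y < 2 * α ∧ u • circ x + v • circ (x + 2 * α) = r • circ (x + y) := by
  have hpi := Real.pi_pos
  have hs : 0 < Real.sin (2 * α) := Real.sin_pos_of_pos_of_lt_pi (by linarith) (by linarith)
  set w : ℂ := ⟨u + v * Real.cos (2 * α), v * Real.sin (2 * α)⟩ with hw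
  have h1 := Complex.norm_mul_cos_arg w
  have h2 := Complex.norm_mul_sin_arg w
  simp only [hw] at h1 h2
  rw [← hw] at h1 h2
  have hvs : 0 < v * Real.sin (2 * α) := by positivity
  have hr : 0 < ‖w‖ := by
    refine (norm_nonneg _).lt_of_ne fun h => ?_
    rw [← h, zero_mul] at h2
    linarith
  have hsin : 0 < Real.sin w.arg := pos_of_mul_pos_right (by rw [h2]; exact hvs) hr.le
  have harg0 : 0 < w.arg := by
    by_contra hneg
    push Not at hneg
    have := Real.sin_nonpos_of_nonpos_of_neg_pi_le hneg (Complex.neg_pi_lt_arg w).le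
    linarith
  have h3 : ‖w‖ * Real.sin (2 * α - w.arg) = u * Real.sin (2 * α) := by
    rw [Real.sin_sub]
    linear_combination Real.sin (2 * α) * h1 - Real.cos (2 * α) * h2
  refine ⟨‖w‖, w.arg, hr, harg0, ?_, ?_⟩
  · by_contra hge
    push Not at hge
    have := Real.sin_nonpos_of_nonpos_of_neg_pi_le (x := 2 * α - w.arg) (by linarith)
      (by linarith [Complex.arg_le_pi w])
    have h4 : 0 < u * Real.sin (2 * α) := by positivity
    rw [← h3] at h4
    have := pos_of_mul_pos_right h4 hr.le
    linarith
  · apply plane_ext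
    · simp only [PiLp.add_apply, PiLp.smul_apply, circ_zero_coord, smul_eq_mul, Real.cos_add]
      linear_combination -Real.cos x * h1 + Real.sin x * h2
    · simp only [PiLp.add_apply, PiLp.smul_apply, circ_one_coord, smul_eq_mul, Real.sin_add]
      linear_combination -Real.sin x * h1 - Real.cos x * h2

theorem eq_of_smul_circ_eq {r r' x y : ℝ} (hr : 0 < r) (hr' : 0 < r')
    (h : r • circ x = r' • circ y) : ∃ k : ℤ, x - y = 2 * Real.pi * k := by
  have h0 : r * Real.cos x = r' * Real.cos y := congrArg (fun w : Plane => w 0) h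
  have h1 : r * Real.sin x = r' * Real.sin y := congrArg (fun w : Plane => w 1) h
  have e : r = r' := by
    have : r ^ 2 = r' ^ 2 := by
      have a := Real.sin_sq_add_cos_sq x
      have b := Real.sin_sq_add_cos_sq y
      have c : (r * Real.cos x) ^ 2 + (r * Real.sin x) ^ 2 =
        (r' * Real.cos y) ^ 2 + (r' * Real.sin y) ^ 2 := by rw [h0, h1]
      linear_combination c - r ^ 2 * a + r' ^ 2 * b
    exact (sq_eq_sq₀ hr.le hr'.le).1 this
  subst e
  exact Real.Angle.angle_eq_iff_two_pi_dvd_sub.1 (Real.Angle.cos_sin_inj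
    (mul_left_cancel₀ hr.ne' h0) (mul_left_cancel₀ hr.ne' h1))

/-- The functional whose level line through `circ x` is a line with slope parameter `w`. -/
def suppFun (w x : ℝ) : Plane →L[ℝ] ℝ := innerSL ℝ (circ x + w • circ (x + Real.pi / 2))

theorem suppFun_circ (w x y : ℝ) :
    suppFun w x (circ (x + y)) = Real.cos y + w * Real.sin y := by
  have := Real.sin_sq_add_cos_sq x
  simp only [suppFun, innerSL_apply_apply, PiLp.inner_apply, Fin.sum_univ_two, PiLp.add_apply,
    PiLp.smul_apply, circ_zero_coord, circ_one_coord, smul_eq_mul, Real.cos_add, Real.sin_add,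
    Real.cos_pi_div_two, Real.sin_pi_div_two, RCLike.inner_apply, conj_trivial]
  linear_combination (Real.cos y + w * Real.sin y) * this

end circle

/-! ### The apex over a side -/

section apex

/-- The apex over a side, in the coordinates given by the ends of the side. -/
theorem exists_apex {M A B : ℝ} (hM : M < 1) (hA : 0 ≤ A) (hB : 0 ≤ B)
    (hA' : A ≤ 2 * M) (hB' : B ≤ 2 * M) :
    ∃ u v : ℝ, 0 ≤ u ∧ 0 ≤ v ∧ u + v = 1 + excess A B ∧ u + (1 - A) * v = 1 ∧
      (1 - B) * u + v = 1 := by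
  rcases (add_nonneg hA hB).lt_or_eq with h | h
  · have hD := excess_denom_pos hM hA hB hA' hB' h
    refine ⟨A / (A + B - A * B), B / (A + B - A * B), by positivity, by positivity, ?_, ?_, ?_⟩
    · unfold excess
      rw [← add_div, eq_comm, ← div_self hD.ne', ← add_div]
      congr 1; ring
    · rw [mul_div_assoc', ← add_div, div_eq_one_iff_eq hD.ne']; ring
    · rw [mul_div_assoc', ← add_div, div_eq_one_iff_eq hD.ne']; ring
  · obtain ⟨rfl, rfl⟩ : A = 0 ∧ B = 0 := ⟨by linarith, by linarith⟩
    exact ⟨1, 0, by simp⟩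

/-- When the excess vanishes, the apex may coincide with a vertex. The midpoint of the side replaces
it, at the price of inequalities, so that both triangles stay nondegenerate. -/
theorem exists_apex_pos {M A B : ℝ} (hM : M < 1) (hA : 0 ≤ A) (hB : 0 ≤ B)
    (hA' : A ≤ 2 * M) (hB' : B ≤ 2 * M) :
    ∃ u v : ℝ, 0 < u ∧ 0 < v ∧ u + v = 1 + excess A B ∧ u + (1 - A) * v ≤ 1 ∧
      (1 - B) * u + v ≤ 1 := by
  by_cases h0 : 0 < excess A B
  · obtain ⟨hA0, hB0⟩ := (excess_pos_iff hM hA hB hA' hB').1 h0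
    obtain ⟨u, v, hu, hv, h1, h2, h3⟩ := exists_apex hM hA hB hA' hB'
    refine ⟨u, v, hu.lt_of_ne ?_, hv.lt_of_ne ?_, h1, h2.le, h3.le⟩
    · rintro rfl
      have : v = 1 := by linarith
      subst this
      linarith
    · rintro rfl
      have : u = 1 := by linarith
      subst this
      linarith
  · have h1 : excess A B = 0 := le_antisymm (not_lt.1 h0) (excess_nonneg hM hA hB hA' hB')
    exact ⟨1 / 2, 1 / 2, by norm_num, by norm_num, by rw [h1]; norm_num, by linarith, by linarith⟩

/-- The quadrilateral with vertices `(0,0)`, `(1,0)`, `(u,v)`, `(0,1)` is the union of two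
triangles. -/
theorem mem_triangle_or_mem_triangle {A B u v x y : ℝ} (hu : 0 ≤ u) (hv : 0 ≤ v)
    (h1 : u + (1 - A) * v = 1) (h2 : (1 - B) * u + v = 1) (hx : 0 ≤ x) (hy : 0 ≤ y)
    (h3 : x + (1 - A) * y ≤ 1) (h4 : (1 - B) * x + y ≤ 1) :
    (∃ a b : ℝ, 0 ≤ a ∧ 0 ≤ b ∧ a + b ≤ 1 ∧ x = a + b * u ∧ y = b * v) ∨
    (∃ a b : ℝ, 0 ≤ a ∧ 0 ≤ b ∧ a + b ≤ 1 ∧ x = a * u ∧ y = a * v + b) := by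
  -- The sign tells on which side of the diagonal through (u, v) the point lies.
  rcases le_total (u * y) (v * x) with h | h
  · left
    rcases hv.lt_or_eq with hv | rfl
    · refine ⟨x - y / v * u, y / v, ?_, by positivity, ?_, by ring, by field_simp⟩
      · rw [sub_nonneg, div_mul_eq_mul_div, div_le_iff₀ hv]; linarith
      · have : y / v = y / v * (u + (1 - A) * v) := by rw [h1, mul_one]
        have h5 : y / v * ((1 - A) * v) = (1 - A) * y := by field_simp
        linarith [mul_add (y / v) u ((1 - A) * v)]
    · have hu1 : u = 1 := by linarith
      subst hu1
      have hy0 : y = 0 := by linarith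
      subst hy0
      exact ⟨x, 0, hx, le_rfl, by linarith, by ring, by ring⟩
  · right
    rcases hu.lt_or_eq with hu | rfl
    · refine ⟨x / u, y - x / u * v, by positivity, ?_, ?_, by field_simp, by ring⟩
      · rw [sub_nonneg, div_mul_eq_mul_div, div_le_iff₀ hu]; linarith
      · have : x / u = x / u * ((1 - B) * u + v) := by rw [h2, mul_one]
        have h5 : x / u * ((1 - B) * u) = (1 - B) * x := by field_simp
        linarith [mul_add (x / u) ((1 - B) * u) v]
    · have hv1 : v = 1 := by linarith
      subst hv1
      have hx0 : x = 0 := by linarith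
      subst hx0
      exact ⟨0, y, le_rfl, hy, by linarith, by ring, by ring⟩

end apex

/-! ### Regular polygons and the upper bound for the area -/

/-- A regular polygon with center `c` and unit circumradius, whose vertices have polar angles
`θ i`, with central angle `2 * α`. -/
structure Frame {n : ℕ} (p : ZMod n → Plane) (c : Plane) (θ : ZMod n → ℝ) (α : ℝ) : Prop where
  five_le : 5 ≤ n
  angle : n * α = Real.pi
  vertex : ∀ i (k : ℕ), p (i + k) = c + circ (θ i + 2 * α * k)
  cover : ∀ x : Plane, ∃ i, ∃ u v : ℝ, 0 ≤ u ∧ 0 ≤ v ∧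
    x = u • circ (θ i) + v • circ (θ i + 2 * α)

theorem exists_frame {n : ℕ} (hn : 5 ≤ n) {p : ZMod n → Plane} (hp : IsUnitRegularNgon p) :
    ∃ c θ, Frame p c θ (Real.pi / n) := by
  obtain ⟨c, φ, hp⟩ := hp
  have hn0 : (0 : ℝ) < n := by exact_mod_cast (by omega : 0 < n)
  have hn5 : (5 : ℝ) ≤ n := by exact_mod_cast hn
  have : NeZero n := ⟨by omega⟩
  have hpi := Real.pi_pos
  have hα0 : 0 < Real.pi / n := by positivity
  have hα : n * (Real.pi / n) = Real.pi := by field_simp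
  have hs : 0 < Real.sin (2 * (Real.pi / n)) :=
    Real.sin_pos_of_pos_of_lt_pi (by linarith) (by nlinarith)
  refine ⟨c, fun i => φ + 2 * (Real.pi / n) * i.val, hn, hα, fun i k => ?_, fun x => ?_⟩
  · have h1 := hp (i.val + k)
    rw [Nat.cast_add, ZMod.natCast_zmod_val] at h1
    rw [h1]
    have e : φ + 2 * Real.pi * ((i.val + k : ℕ) : ℝ) / n =
        φ + 2 * (Real.pi / n) * i.val + 2 * (Real.pi / n) * k := by
      push_cast; ring
    rw [e]
    rfl
  · obtain ⟨r, η, hr, rfl⟩ := exists_polar x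
    -- Reduce the polar angle to [0, 2π); the floor of its quotient by 2α then selects the sector.
    set y := toIcoMod Real.two_pi_pos 0 (η - φ) with hy
    have hy1 := toIcoMod_mem_Ico Real.two_pi_pos 0 (η - φ)
    rw [← hy, zero_add] at hy1
    have hyη : circ η = circ (φ + y) := by
      have : φ + y = η - toIcoDiv Real.two_pi_pos 0 (η - φ) * (2 * Real.pi) := by
        rw [hy, ← self_sub_toIcoDiv_zsmul, zsmul_eq_mul]; ring
      rw [this]
      apply plane_ext
      · simp [Real.cos_sub_int_mul_two_pi]
      · simp [Real.sin_sub_int_mul_two_pi]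
    set k := ⌊y / (2 * (Real.pi / n))⌋₊ with hk
    have h2α : 0 < 2 * (Real.pi / n) := by linarith
    have hk1 : (k : ℝ) ≤ y / (2 * (Real.pi / n)) := Nat.floor_le (div_nonneg hy1.1 h2α.le)
    have hk2 : y / (2 * (Real.pi / n)) < k + 1 := Nat.lt_floor_add_one _
    rw [le_div_iff₀ h2α] at hk1
    rw [div_lt_iff₀ h2α] at hk2
    have hkn : k < n := by
      have : (k : ℝ) < n := by
        by_contra hcon
        push Not at hcon
        nlinarith [hy1.2]
      exact_mod_cast this
    have hcomb := circ_add_eq_combination hs.ne' (φ + 2 * (Real.pi / n) * k)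
      (y - 2 * (Real.pi / n) * k)
    rw [show φ + 2 * (Real.pi / n) * k + (y - 2 * (Real.pi / n) * k) = φ + y by ring] at hcomb
    have hpos : ∀ w, 0 ≤ w → w ≤ 2 * (Real.pi / n) →
        0 ≤ r * (Real.sin w / Real.sin (2 * (Real.pi / n))) := fun w h0 h1 =>
      mul_nonneg hr (div_nonneg (Real.sin_nonneg_of_nonneg_of_le_pi h0 (by nlinarith)) hs.le)
    exact ⟨(k : ZMod n), r * (Real.sin (2 * (Real.pi / n) - (y - 2 * (Real.pi / n) * k)) /
      Real.sin (2 * (Real.pi / n))), r * (Real.sin (y - 2 * (Real.pi / n) * k) /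
      Real.sin (2 * (Real.pi / n))), hpos _ (by linarith) (by linarith),
      hpos _ (by linarith) (by linarith), by
        rw [hyη, hcomb, smul_add, smul_smul, smul_smul, ZMod.val_natCast_of_lt hkn]⟩

namespace Frame

variable {n : ℕ} {p : ZMod n → Plane} {c : Plane} {θ : ZMod n → ℝ} {α : ℝ}

theorem alpha_pos (hF : Frame p c θ α) : 0 < α := by
  have h1 := hF.angle
  have hn5 : (5 : ℝ) ≤ n := by exact_mod_cast hF.five_le
  by_contra hcon
  push Not at hcon
  nlinarith [Real.pi_pos]

theorem two_alpha_lt (hF : Frame p c θ α) : 2 * α < Real.pi / 2 := by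
  have h1 := hF.angle
  have hn5 : (5 : ℝ) ≤ n := by exact_mod_cast hF.five_le
  nlinarith [hF.alpha_pos]

theorem sin_pos (hF : Frame p c θ α) : 0 < Real.sin (2 * α) :=
  Real.sin_pos_of_pos_of_lt_pi (by linarith [hF.alpha_pos])
    (by linarith [hF.two_alpha_lt, Real.pi_pos])

theorem cos_two_pos (hF : Frame p c θ α) : 0 < Real.cos (2 * α) :=
  Real.cos_pos_of_mem_Ioo ⟨by linarith [hF.alpha_pos, Real.pi_pos], hF.two_alpha_lt⟩

theorem cos_pos (hF : Frame p c θ α) : 0 < Real.cos α :=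
  Real.cos_pos_of_mem_Ioo ⟨by linarith [hF.alpha_pos, Real.pi_pos],
    by linarith [hF.alpha_pos, hF.two_alpha_lt]⟩

theorem cos_two_lt_one (hF : Frame p c θ α) : Real.cos (2 * α) < 1 := by
  rw [← Real.cos_zero]
  exact Real.cos_lt_cos_of_nonneg_of_le_pi_div_two le_rfl hF.two_alpha_lt.le
    (by linarith [hF.alpha_pos])

theorem tan_pos (hF : Frame p c θ α) : 0 < Real.tan α :=
  Real.tan_pos_of_pos_of_lt_pi_div_two hF.alpha_pos
    (by linarith [hF.alpha_pos, hF.two_alpha_lt])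

theorem tan_mul_sin (hF : Frame p c θ α) :
    Real.tan α * Real.sin (2 * α) = 1 - Real.cos (2 * α) := by
  rw [← tan_mul_one_add_cos hF.cos_pos.ne', ← tan_sq_mul_one_add_cos hF.cos_pos.ne']; ring

theorem vertex_self (hF : Frame p c θ α) (i : ZMod n) : p i = c + circ (θ i) := by
  simpa using hF.vertex i 0

theorem vertex_next (hF : Frame p c θ α) (i : ZMod n) : p (i + 1) = c + circ (θ i + 2 * α) := by
  simpa using hF.vertex i 1

theorem circ_next (hF : Frame p c θ α) (i : ZMod n) (x : ℝ) :
    circ (θ (i + 1) + x) = circ (θ i + 2 * α + x) := by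
  apply circ_add_congr
  have := hF.vertex_self (i + 1)
  rw [hF.vertex_next] at this
  exact (add_left_cancel this).symm

theorem circ_prev (hF : Frame p c θ α) (i : ZMod n) :
    circ (θ i) = circ (θ (i + 1) - 2 * α) := by
  rw [sub_eq_add_neg, hF.circ_next]; ring_nf

/-- Because tan α sin 2α = 1 − cos 2α, scaling slopes by tan α makes r = 1 the line of the side that
starts at the vertex and r = −1 that of the preceding side. -/
theorem suppFun_left (hF : Frame p c θ α) (r : ℝ) (i : ZMod n) (u v : ℝ) :
    suppFun (Real.tan α * r) (θ i) (u • circ (θ i) + v • circ (θ i + 2 * α)) =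
      u + (1 - (1 - Real.cos (2 * α)) * (1 - r)) * v := by
  have h1 := suppFun_circ (Real.tan α * r) (θ i) 0
  rw [add_zero, Real.cos_zero, Real.sin_zero] at h1
  rw [map_add, map_smul, map_smul, suppFun_circ, h1, smul_eq_mul, smul_eq_mul]
  linear_combination v * r * hF.tan_mul_sin

theorem suppFun_right (hF : Frame p c θ α) (r : ℝ) (i : ZMod n) (u v : ℝ) :
    suppFun (Real.tan α * r) (θ (i + 1)) (u • circ (θ i) + v • circ (θ i + 2 * α)) =
      (1 - (1 - Real.cos (2 * α)) * (1 + r)) * u + v := by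
  have h1 := suppFun_circ (Real.tan α * r) (θ (i + 1)) 0
  have h2 := suppFun_circ (Real.tan α * r) (θ (i + 1)) (-(2 * α))
  rw [← sub_eq_add_neg, ← hF.circ_prev, Real.cos_neg, Real.sin_neg] at h2
  rw [hF.circ_next, Real.cos_zero, Real.sin_zero, add_zero] at h1
  rw [map_add, map_smul, map_smul, h1, h2, smul_eq_mul, smul_eq_mul]
  linear_combination - u * r * hF.tan_mul_sin

/-- The supporting lines of a circumscribed polygon at the vertices. -/
theorem exists_slopes (hF : Frame p c θ α) {Q : Set Plane} (hQ : IsCircumscribed p Q) :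
    ∃ z : ZMod n → ℝ, Slopes z ∧
      ∀ i, ∀ x ∈ Q, suppFun (Real.tan α * z i) (θ i) (x - c) ≤ 1 := by
  obtain ⟨⟨⟨F, hFin, rfl⟩, hint⟩, hsub, hfr⟩ := hQ
  suffices h : ∀ i, ∃ r ∈ Set.Icc (-1 : ℝ) 1, ∀ x ∈ convexHull ℝ F,
      suppFun (Real.tan α * r) (θ i) (x - c) ≤ 1 by
    choose z hz hz' using h
    exact ⟨z, hz, hz'⟩
  intro i
  obtain ⟨f, hf0, hf⟩ := exists_support (convex_convexHull ℝ F) hint (hfr i)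
  have hmem : ∀ j, p j ∈ convexHull ℝ F := fun j => hsub (subset_convexHull ℝ _ ⟨j, rfl⟩)
  have hcirc : ∀ y, f (circ (θ i + y)) =
      Real.cos y * f (circ (θ i)) + Real.sin y * f (circ (θ i + Real.pi / 2)) := by
    intro y
    rw [circ_add, map_add, map_smul, map_smul, smul_eq_mul, smul_eq_mul]
  generalize ha : f (circ (θ i)) = a at hcirc
  generalize f (circ (θ i + Real.pi / 2)) = b at hcirc
  have hs := hF.sin_pos
  have ht := hF.tan_pos
  have hM : 0 < 1 - Real.cos (2 * α) := by linarith [hF.cos_two_lt_one]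
  have n1 := hf _ (hmem (i + 1))
  rw [hF.vertex_next, hF.vertex_self, map_add, map_add, hcirc, ha] at n1
  have n2 := hf _ (hmem (i - 1))
  have e : circ (θ (i - 1)) = circ (θ i + -(2 * α)) := by
    have := hF.circ_prev (i - 1)
    rwa [sub_add_cancel, sub_eq_add_neg (θ i)] at this
  rw [hF.vertex_self (i - 1), hF.vertex_self i, map_add, map_add, e, hcirc, ha, Real.cos_neg,
    Real.sin_neg] at n2
  -- The two neighbouring vertices give a(1 − cos 2α) ≥ |b| sin 2α. Hence a ≥ 0, and a = 0 would
  -- force f = 0. The same inequality bounds the normalized slope by 1.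
  have ha0 : 0 ≤ a := by nlinarith
  have hts := hF.tan_mul_sin
  have ha1 : 0 < a := by
    refine ha0.lt_of_ne fun h0 => hf0 ?_
    have hb : b = 0 := by
      subst h0
      have : Real.sin (2 * α) * b = 0 := by linarith
      exact (mul_eq_zero.1 this).resolve_left hs.ne'
    ext x
    obtain ⟨r, y, -, rfl⟩ := exists_polar x
    have := hcirc (y - θ i)
    rw [add_sub_cancel, ← h0, hb] at this
    rw [map_smul, this]
    simp
  have hat : 0 < a * Real.tan α := by positivity
  refine ⟨b / (a * Real.tan α), ⟨?_, ?_⟩, fun x hx => ?_⟩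
  · rw [le_div_iff₀ hat]
    apply le_of_mul_le_mul_right _ hs
    nlinarith
  · rw [div_le_iff₀ hat]
    apply le_of_mul_le_mul_right _ hs
    nlinarith
  · have h1 := hf x hx
    rw [hF.vertex_self, map_add, ha] at h1
    have h2 : f (x - c) = a * suppFun (Real.tan α * (b / (a * Real.tan α))) (θ i) (x - c) := by
      obtain ⟨r, y, -, hxy⟩ := exists_polar (x - c)
      have h3 := hcirc (y - θ i)
      have h4 := suppFun_circ (Real.tan α * (b / (a * Real.tan α))) (θ i) (y - θ i)
      rw [add_sub_cancel] at h3 h4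
      rw [hxy, map_smul, map_smul, h3, h4, smul_eq_mul, smul_eq_mul]
      field_simp
    rw [map_sub] at h2
    have h5 : a * suppFun (Real.tan α * (b / (a * Real.tan α))) (θ i) (x - c) ≤ a * 1 := by
      rw [← h2]; linarith
    exact le_of_mul_le_mul_left h5 ha1

/-- A used side is cut off by its own line. -/
theorem add_le_one_of_side_subset (hF : Frame p c θ α) {Q : Set Plane} (hQ : IsCircumscribed p Q)
    {i : ZMod n} (hi : side p i ⊆ frontier Q) {u v : ℝ}
    (huv : c + (u • circ (θ i) + v • circ (θ i + 2 * α)) ∈ Q) : u + v ≤ 1 := by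
  obtain ⟨⟨⟨F, hFin, rfl⟩, hint⟩, hsub, -⟩ := hQ
  have hmid : (1 / 2 : ℝ) • p i + (1 / 2 : ℝ) • p (i + 1) ∈ frontier (convexHull ℝ F) :=
    hi ⟨1 / 2, 1 / 2, by norm_num, by norm_num, by norm_num, rfl⟩
  obtain ⟨f, hf0, hf⟩ := exists_support (convex_convexHull ℝ F) hint hmid
  have hmem : ∀ j, p j ∈ convexHull ℝ F := fun j => hsub (subset_convexHull ℝ _ ⟨j, rfl⟩)
  have n0 := hf _ (hmem i)
  have n1 := hf _ (hmem (i + 1))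
  have n2 := hf _ (hmem (i - 1))
  have n3 := hf _ huv
  have e : circ (θ (i - 1)) = circ (θ i + -(2 * α)) := by
    have := hF.circ_prev (i - 1)
    rwa [sub_add_cancel, sub_eq_add_neg (θ i)] at this
  have hs := hF.sin_pos
  have e2 : circ (θ i + -(2 * α)) =
      (2 * Real.cos (2 * α)) • circ (θ i) + (-1 : ℝ) • circ (θ i + 2 * α) := by
    rw [circ_add_eq_combination hs.ne']
    congr 2
    · rw [sub_neg_eq_add, ← two_mul, Real.sin_two_mul]; field_simp
    · rw [Real.sin_neg, neg_div, div_self hs.ne']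
  rw [hF.vertex_self, e, e2] at n2
  rw [hF.vertex_next, hF.vertex_self i] at n0 n1 n2 n3
  simp only [map_add, map_smul, smul_eq_mul] at n0 n1 n2 n3
  generalize ha : f (circ (θ i)) = a at *
  generalize hb : f (circ (θ i + 2 * α)) = b at *
  -- A functional maximal at the midpoint of the side is constant on the side, so f is a positive
  -- multiple of u + v once the previous vertex excludes the wrong sign.
  have hab : b = a := by linarith
  subst hab
  have hM := hF.cos_two_lt_one
  have hb0 : 0 ≤ b := by nlinarith
  have hb1 : 0 < b := by
    refine hb0.lt_of_ne fun h0 => hf0 ?_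
    ext x
    obtain ⟨r, y, -, rfl⟩ := exists_polar x
    have := circ_add_eq_combination hs.ne' (θ i) (y - θ i)
    rw [add_sub_cancel] at this
    rw [this]
    simp [ha, hb, ← h0]
  nlinarith

/-- Inside the cone over a side, the two half-planes leave a quadrilateral, split by the ray to the
apex into triangles of areas v sin(2α)/2 and u sin(2α)/2. -/
theorem volume_sector_le (hF : Frame p c θ α) {S : Set Plane} {A B : ℝ} (i : ZMod n)
    (hA : 0 ≤ A) (hB : 0 ≤ B)
    (hA' : A ≤ 2 * (1 - Real.cos (2 * α))) (hB' : B ≤ 2 * (1 - Real.cos (2 * α)))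
    (hS : ∀ u v : ℝ, u • circ (θ i) + v • circ (θ i + 2 * α) ∈ S → u + (1 - A) * v ≤ 1 ∧
      (1 - B) * u + v ≤ 1) :
    volume (S ∩ {x | ∃ u v : ℝ, 0 ≤ u ∧ 0 ≤ v ∧ x = u • circ (θ i) + v • circ (θ i + 2 * α)}) ≤
      ENNReal.ofReal (Real.sin (2 * α) / 2 * (1 + excess A B)) := by
  have hs := hF.sin_pos
  obtain ⟨u, v, hu, hv, h1, h2, h3⟩ := exists_apex (by linarith [hF.cos_two_pos]) hA hB hA' hB'
  set q : Plane := u • circ (θ i) + v • circ (θ i + 2 * α) with hq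
  have hsub : S ∩ {x | ∃ u v : ℝ, 0 ≤ u ∧ 0 ≤ v ∧ x = u • circ (θ i) + v • circ (θ i + 2 * α)} ⊆
      triMap (circ (θ i)) q '' stdTriangle ∪ triMap q (circ (θ i + 2 * α)) '' stdTriangle := by
    rintro _ ⟨hxS, x, y, hx, hy, rfl⟩
    obtain ⟨h4, h5⟩ := hS x y hxS
    rcases mem_triangle_or_mem_triangle hu hv h2 h3 hx hy h4 h5 with
      ⟨a, b, ha, hb, hab, rfl, rfl⟩ | ⟨a, b, ha, hb, hab, rfl, rfl⟩
    · left
      refine ⟨!₂[a, b], ⟨by simpa, by simpa, by simpa⟩, ?_⟩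
      rw [triMap_apply, hq]
      simp only [Matrix.cons_val_zero, Matrix.cons_val_one]
      module
    · right
      refine ⟨!₂[a, b], ⟨by simpa, by simpa, by simpa⟩, ?_⟩
      rw [triMap_apply, hq]
      simp only [Matrix.cons_val_zero, Matrix.cons_val_one]
      module
  have c1 : cross (circ (θ i)) q = v * Real.sin (2 * α) := by
    rw [hq, cross_add_right, cross_self, cross_circ]; ring
  have c2 : cross q (circ (θ i + 2 * α)) = u * Real.sin (2 * α) := by
    rw [hq, cross_add_left, cross_self, cross_circ]; ring
  calc _ ≤ _ := measure_mono hsub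
    _ ≤ _ := measure_union_le _ _
    _ ≤ _ := add_le_add (volume_triangle_le _ _) (volume_triangle_le _ _)
    _ = _ := by
      rw [c1, c2, abs_of_nonneg (by positivity), abs_of_nonneg (by positivity),
        ← ENNReal.ofReal_add (by positivity) (by positivity), ← h1]
      congr 1; ring

/-- The set W collects sides known to be cut off by their own lines, whose excess may be dropped. It
is empty for the general bound and a singleton when used sides are identified. -/
theorem area_le [NeZero n] (hF : Frame p c θ α) {Q : Set Plane} {z : ZMod n → ℝ} (hz : Slopes z)
    (hsup : ∀ i, ∀ x ∈ Q, suppFun (Real.tan α * z i) (θ i) (x - c) ≤ 1) (W : Finset (ZMod n))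
    (hW : ∀ i ∈ W, ∀ u v : ℝ, c + (u • circ (θ i) + v • circ (θ i + 2 * α)) ∈ Q → u + v ≤ 1) :
    area Q ≤ Real.sin (2 * α) / 2 *
      ∑ i, (1 + if i ∈ W then 0 else sideExcess (1 - Real.cos (2 * α)) z i) := by
  have hs := hF.sin_pos
  have hM : 0 ≤ 1 - Real.cos (2 * α) := by linarith [hF.cos_two_lt_one]
  have hM1 : 1 - Real.cos (2 * α) < 1 := by linarith [hF.cos_two_pos]
  have b := fun j => slope_mem_Icc hM (hz j)
  have hnn : ∀ i, 0 ≤ 1 + if i ∈ W then 0 else sideExcess (1 - Real.cos (2 * α)) z i := by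
    intro i
    split_ifs
    · norm_num
    · have := excess_nonneg hM1 (b i).1 (b (i + 1)).2.2.1 (b i).2.1 (b (i + 1)).2.2.2
      unfold sideExcess
      linarith
  unfold area
  apply ENNReal.toReal_le_of_le_ofReal
    (mul_nonneg (by positivity) (Finset.sum_nonneg fun i _ => hnn i))
  rw [← measure_preimage_add volume c Q, Finset.mul_sum,
    ENNReal.ofReal_sum_of_nonneg fun i _ => mul_nonneg (by positivity) (hnn i)]
  have hcov : (fun x => c + x) ⁻¹' Q ⊆ ⋃ i, ((fun x => c + x) ⁻¹' Q ∩
      {x | ∃ u v : ℝ, 0 ≤ u ∧ 0 ≤ v ∧ x = u • circ (θ i) + v • circ (θ i + 2 * α)}) := by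
    intro x hx
    obtain ⟨i, hi⟩ := hF.cover x
    exact Set.mem_iUnion.2 ⟨i, hx, hi⟩
  refine (measure_mono hcov).trans ((measure_iUnion_fintype_le _ _).trans ?_)
  refine Finset.sum_le_sum fun i _ => ?_
  split_ifs with hi
  · have := hF.volume_sector_le (S := (fun x => c + x) ⁻¹' Q) (A := 0) (B := 0) i le_rfl le_rfl
      (by linarith) (by linarith) fun u v huv => by
        have := hW i hi u v huv
        constructor <;> linarith
    rwa [excess_zero_left] at this
  · refine hF.volume_sector_le (S := (fun x => c + x) ⁻¹' Q) i (b i).1 (b (i + 1)).2.2.1 (b i).2.1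
      (b (i + 1)).2.2.2 fun u v huv => ?_
    have h1 := hsup i _ huv
    have h2 := hsup (i + 1) _ huv
    rw [add_sub_cancel_left] at h1 h2
    rw [hF.suppFun_left] at h1
    rw [hF.suppFun_right] at h2
    exact ⟨h1, h2⟩

end Frame

/-! ### Construction of a circumscribed polygon from its slopes -/

theorem cos_mul_le_cos_mul {n a m : ℕ} {α : ℝ} (hα : n * α = Real.pi) (hα0 : 0 ≤ α) (ham : a ≤ m)
    (hm : m + a ≤ 2 * n) : Real.cos (m * α) ≤ Real.cos (a * α) := by
  have h1 : (a : ℝ) ≤ m := by exact_mod_cast ham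
  have h2 : (m : ℝ) + a ≤ 2 * n := by exact_mod_cast hm
  have h0 : (0 : ℝ) ≤ a := Nat.cast_nonneg a
  rcases le_total (m : ℝ) n with h | h
  · exact Real.cos_le_cos_of_nonneg_of_le_pi (by positivity) (by nlinarith) (by nlinarith)
  · have e : Real.cos (m * α) = Real.cos ((2 * n - m) * α) := by
      rw [← Real.cos_two_pi_sub, ← hα]; ring_nf
    rw [e]
    exact Real.cos_le_cos_of_nonneg_of_le_pi (by positivity) (by nlinarith) (by nlinarith)

/-- A supporting line is between the lines of the two adjacent sides. -/
theorem cos_add_tan_mul_sin_le {α r x d : ℝ} (hc : 0 < Real.cos α) (hr : r ∈ Set.Icc (-1 : ℝ) 1)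
    (h1 : Real.cos (x - α) ≤ d * Real.cos α) (h2 : Real.cos (x + α) ≤ d * Real.cos α) :
    Real.cos x + Real.tan α * r * Real.sin x ≤ d := by
  rw [Real.cos_sub] at h1
  rw [Real.cos_add] at h2
  -- The expression is affine in r, with values cos(x ∓ α)/cos α at r = ±1, so the two extreme
  -- slopes suffice.
  have e : Real.cos x + Real.tan α * r * Real.sin x =
      (Real.cos x * Real.cos α + r * (Real.sin x * Real.sin α)) / Real.cos α := by
    rw [Real.tan_eq_sin_div_cos]; field_simp
  rw [e, div_le_iff₀ hc]
  obtain ⟨r1, r2⟩ := hr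
  nlinarith

theorem convex_openStdTriangle : Convex ℝ openStdTriangle := by
  let e0 : Plane →L[ℝ] ℝ := EuclideanSpace.proj 0
  let e1 : Plane →L[ℝ] ℝ := EuclideanSpace.proj 1
  have h0 : Convex ℝ {w : Plane | 0 < w 0} := convex_halfSpace_gt (f := e0) e0.isLinear 0
  have h1 : Convex ℝ {w : Plane | 0 < w 1} := convex_halfSpace_gt (f := e1) e1.isLinear 0
  have h2 : Convex ℝ {w : Plane | w 0 + w 1 < 1} :=
    convex_halfSpace_lt (f := e0 + e1) (e0 + e1).isLinear 1
  exact h0.inter (h1.inter h2)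

theorem nullMeasurableSet_triangle (a b : Plane) :
    NullMeasurableSet (triMap a b '' openStdTriangle) :=
  (convex_openStdTriangle.linear_image _).nullMeasurableSet volume

theorem triangle_subset {Q : Set Plane} (hQ : Convex ℝ Q) {a b c : Plane} (h0 : c ∈ Q)
    (ha : c + a ∈ Q) (hb : c + b ∈ Q) :
    triMap a b '' openStdTriangle ⊆ (fun x => c + x) ⁻¹' Q := by
  rintro _ ⟨w, ⟨w0, w1, w2⟩, rfl⟩
  have := hQ.sum_mem (t := Finset.univ) (w := ![1 - w 0 - w 1, w 0, w 1])
    (z := ![c, c + a, c + b]) (by intro i _; fin_cases i <;> simp <;> linarith)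
    (by simp [Fin.sum_univ_three]; ring) (by intro i _; fin_cases i <;> simp [h0, ha, hb])
  simp only [Fin.sum_univ_three, Matrix.cons_val_zero, Matrix.cons_val_one, Matrix.cons_val] at this
  rw [Set.mem_preimage, triMap_apply]
  convert this using 1
  module

theorem disjoint_triangle {a b q : Plane} (h1 : 0 < cross a q) (h2 : 0 < cross q b) :
    Disjoint (triMap a q '' openStdTriangle) (triMap q b '' openStdTriangle) := by
  rw [Set.disjoint_left]
  rintro _ ⟨w, ⟨w0, w1, -⟩, rfl⟩ ⟨w', ⟨w0', w1', -⟩, he⟩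
  have h3 := congrArg (cross q) he
  rw [triMap_apply, triMap_apply, cross_add_right, cross_add_right, cross_self] at h3
  have c3 : cross q a = - cross a q := by simp only [cross]; ring
  rw [c3] at h3
  have := mul_pos w1' h2
  have := mul_pos w0 h1
  linarith

namespace Frame

variable {n : ℕ} {p : ZMod n → Plane} {c : Plane} {θ : ZMod n → ℝ} {α : ℝ}

theorem suppFun_le_one (hF : Frame p c θ α) {r : ℝ} (hr : r ∈ Set.Icc (-1 : ℝ) 1) {k : ℕ}
    (hk : k < n) : Real.cos (2 * α * k) + Real.tan α * r * Real.sin (2 * α * k) ≤ 1 := by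
  rcases Nat.eq_zero_or_pos k with rfl | hk0
  · simp
  · have h0 := hF.alpha_pos.le
    apply cos_add_tan_mul_sin_le hF.cos_pos hr
    · have := cos_mul_le_cos_mul hF.angle h0 (a := 1) (m := 2 * k - 1) (by omega) (by omega)
      rw [Nat.cast_sub (by omega)] at this
      push_cast at this
      rw [one_mul] at this
      rw [one_mul]
      convert this using 2
      ring
    · have := cos_mul_le_cos_mul hF.angle h0 (a := 1) (m := 2 * k + 1) (by omega) (by omega)
      push_cast at this
      rw [one_mul] at this
      rw [one_mul]
      convert this using 2
      ring

/-- Vertices at least two steps away are at angular distance at least 3α from the midpoint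
directions of both adjacent sides, and cos 3α = (2 cos 2α − 1) cos α. -/
theorem suppFun_le_of_two_le (hF : Frame p c θ α) {r : ℝ} (hr : r ∈ Set.Icc (-1 : ℝ) 1) {k : ℕ}
    (hk2 : 2 ≤ k) (hk : k + 2 ≤ n) :
    Real.cos (2 * α * k) + Real.tan α * r * Real.sin (2 * α * k) ≤
      1 - 2 * (1 - Real.cos (2 * α)) := by
  have h0 := hF.alpha_pos.le
  have e : Real.cos (3 * α) = (1 - 2 * (1 - Real.cos (2 * α))) * Real.cos α := by
    rw [Real.cos_three_mul, Real.cos_two_mul]; ring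
  apply cos_add_tan_mul_sin_le hF.cos_pos hr
  · have := cos_mul_le_cos_mul hF.angle h0 (a := 3) (m := 2 * k - 1) (by omega) (by omega)
    rw [Nat.cast_sub (by omega)] at this
    push_cast at this
    rw [← e]
    convert this using 2
    ring
  · have := cos_mul_le_cos_mul hF.angle h0 (a := 3) (m := 2 * k + 1) (by omega) (by omega)
    push_cast at this
    rw [← e]
    convert this using 2
    ring

/-- The apex over a side lies on the inner side of all the supporting lines. -/
theorem suppFun_apex_le_one (hF : Frame p c θ α) [NeZero n] {z : ZMod n → ℝ} (hz : Slopes z)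
    {j : ZMod n} {u v : ℝ} (hu : 0 ≤ u) (hv : 0 ≤ v)
    (h1 : u + (1 - (1 - Real.cos (2 * α)) * (1 - z j)) * v ≤ 1)
    (h2 : (1 - (1 - Real.cos (2 * α)) * (1 + z (j + 1))) * u + v ≤ 1) (i : ZMod n) :
    suppFun (Real.tan α * z i) (θ i) (u • circ (θ j) + v • circ (θ j + 2 * α)) ≤ 1 := by
  have hn := hF.five_le
  rcases eq_or_ne i j with rfl | hij
  · rwa [hF.suppFun_left]
  rcases eq_or_ne i (j + 1) with rfl | hij'
  · rwa [hF.suppFun_right]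
  have hM : 0 < 1 - Real.cos (2 * α) := by linarith [hF.cos_two_lt_one]
  obtain ⟨k, hkn, rfl⟩ : ∃ k : ℕ, k < n ∧ j = i + k :=
    ⟨(j - i).val, ZMod.val_lt _, by rw [ZMod.natCast_zmod_val]; ring⟩
  have hk0 : k ≠ 0 := by
    rintro rfl
    simp at hij
  have hk1 : k + 1 ≠ n := by
    intro h
    apply hij'
    have : ((k + 1 : ℕ) : ZMod n) = 0 := by simp [h]
    rw [Nat.cast_add, Nat.cast_one] at this
    rw [add_assoc, this, add_zero]
  have e0 : circ (θ (i + k)) = circ (θ i + 2 * α * k) := by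
    have := hF.vertex i k
    rw [hF.vertex_self] at this
    exact add_left_cancel this
  have e1 : circ (θ (i + k) + 2 * α) = circ (θ i + 2 * α * (k + 1 : ℕ)) := by
    rw [circ_add_congr e0]
    push_cast
    ring_nf
  rw [map_add, map_smul, map_smul, e0, e1, suppFun_circ, suppFun_circ, smul_eq_mul, smul_eq_mul]
  -- Replace the actual slopes by the extreme ones: the apex stays within the lines of the two
  -- neighbouring sides, which is all that the remaining cases need.
  have g1 : u + (1 - 2 * (1 - Real.cos (2 * α))) * v ≤ 1 := by
    have : 0 ≤ (1 - Real.cos (2 * α)) * (1 + z (i + k)) * v :=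
      mul_nonneg (mul_nonneg hM.le (by linarith [(hz (i + k)).1])) hv
    nlinarith
  have g2 : (1 - 2 * (1 - Real.cos (2 * α))) * u + v ≤ 1 := by
    have : 0 ≤ (1 - Real.cos (2 * α)) * (1 - z (i + k + 1)) * u :=
      mul_nonneg (mul_nonneg hM.le (by linarith [(hz (i + k + 1)).2])) hu
    nlinarith
  rcases eq_or_ne k 1 with rfl | hk2
  · have b1 := hF.suppFun_le_one (hz i) hkn
    have b2 := hF.suppFun_le_of_two_le (hz i) (k := 1 + 1) (by omega) (by omega)
    nlinarith [mul_le_mul_of_nonneg_left b1 hu, mul_le_mul_of_nonneg_left b2 hv]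
  · have b1 := hF.suppFun_le_of_two_le (hz i) (k := k) (by omega) (by omega)
    rcases eq_or_ne (k + 2) n with hk3 | hk3
    · have b2 := hF.suppFun_le_one (hz i) (k := k + 1) (by omega)
      nlinarith [mul_le_mul_of_nonneg_left b1 hu, mul_le_mul_of_nonneg_left b2 hv]
    · have b2 := hF.suppFun_le_of_two_le (hz i) (k := k + 1) (by omega) (by omega)
      have b1' := mul_le_mul_of_nonneg_left b1 hu
      have b2' := mul_le_mul_of_nonneg_left b2 hv
      have hg : 1 - 2 * (1 - Real.cos (2 * α)) ≤ 1 := by linarith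
      generalize 1 - 2 * (1 - Real.cos (2 * α)) = g at *
      -- Adding g1 and g2 gives (u + v)(1 + g) ≤ 2, and 2g ≤ 1 + g; for g ≤ 0 the claim is trivial.
      have : (u + v) * g ≤ 1 := by
        rcases le_total g 0 with hg0 | hg0
        · nlinarith
        · nlinarith
      linarith

/-- The open sectors spanned by the sides are disjoint. -/
theorem sector_disjoint (hF : Frame p c θ α) [NeZero n] {i j : ZMod n} {u v u' v' : ℝ}
    (hu : 0 < u) (hv : 0 < v) (hu' : 0 < u') (hv' : 0 < v')
    (h : u • circ (θ i) + v • circ (θ i + 2 * α) = u' • circ (θ j) + v' • circ (θ j + 2 * α)) :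
    i = j := by
  have h0 := hF.alpha_pos
  obtain ⟨k, hkn, rfl⟩ : ∃ k : ℕ, k < n ∧ j = i + k :=
    ⟨(j - i).val, ZMod.val_lt _, by rw [ZMod.natCast_zmod_val]; ring⟩
  have e0 : circ (θ (i + k)) = circ (θ i + 2 * α * k) := by
    have := hF.vertex i k
    rw [hF.vertex_self] at this
    exact add_left_cancel this
  obtain ⟨r, y, hr, hy0, hy1, hry⟩ := exists_polar_of_cone h0 hF.two_alpha_lt hu hv (θ i)
  obtain ⟨r', y', hr', hy0', hy1', hry'⟩ :=
    exists_polar_of_cone h0 hF.two_alpha_lt hu' hv' (θ (i + k))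
  rw [hry, hry', circ_add_congr e0] at h
  obtain ⟨m, hm⟩ := eq_of_smul_circ_eq hr' hr h.symm
  have hk1 : (k : ℝ) + 1 ≤ n := by exact_mod_cast hkn
  have hk0 : (0 : ℝ) ≤ k := Nat.cast_nonneg k
  have hpi := Real.pi_pos
  have ha := hF.angle
  have hm1 : (m : ℝ) < 1 := by
    by_contra hcon
    push Not at hcon
    nlinarith
  have hm0 : (-1 : ℝ) < m := by
    by_contra hcon
    push Not at hcon
    have : 2 * α * k ≥ 0 := by positivity
    nlinarith [hF.two_alpha_lt]
  have hm2 : m = 0 := by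
    have a : m < 1 := by exact_mod_cast hm1
    have b : -1 < m := by exact_mod_cast hm0
    omega
  subst hm2
  rcases Nat.eq_zero_or_pos k with rfl | hk
  · simp
  · exfalso
    have : (1 : ℝ) ≤ k := by exact_mod_cast hk
    have : 2 * α ≤ 2 * α * k := by nlinarith
    simp at hm
    linarith

/-- The hull stays within all supporting lines by `suppFun_apex_le_one` and contains the disjoint
open triangles of all sectors. A lower bound for the area is enough, as `area_le` gives the other
direction. -/
theorem exists_isCircumscribed (hF : Frame p c θ α) [NeZero n] {z : ZMod n → ℝ} (hz : Slopes z) :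
    ∃ Q, IsCircumscribed p Q ∧
      (∀ i, ∀ x ∈ Q, suppFun (Real.tan α * z i) (θ i) (x - c) ≤ 1) ∧
      Real.sin (2 * α) / 2 * ∑ i, (1 + sideExcess (1 - Real.cos (2 * α)) z i) ≤ area Q := by
  have hs := hF.sin_pos
  have hM : 0 ≤ 1 - Real.cos (2 * α) := by linarith [hF.cos_two_lt_one]
  have hM1 : 1 - Real.cos (2 * α) < 1 := by linarith [hF.cos_two_pos]
  have b := fun j => slope_mem_Icc hM (hz j)
  have hap := fun i => exists_apex_pos hM1 (b i).1 (b (i + 1)).2.2.1 (b i).2.1 (b (i + 1)).2.2.2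
  choose u v hu hv huv h1 h2 using hap
  set q : ZMod n → Plane := fun i => u i • circ (θ i) + v i • circ (θ i + 2 * α) with hq
  -- The centre is included so that the triangles with apex c lie in the hull at once.
  set F : Set Plane := insert c (Set.range p ∪ Set.range fun i => c + q i)
  have hfin : F.Finite := ((Set.finite_range _).union (Set.finite_range _)).insert c
  have hcF : c ∈ convexHull ℝ F := subset_convexHull ℝ F (Or.inl rfl)
  have hpF : ∀ i, p i ∈ convexHull ℝ F := fun i =>
    subset_convexHull ℝ F (Or.inr (Or.inl ⟨i, rfl⟩))
  have hqF : ∀ i, c + q i ∈ convexHull ℝ F := fun i =>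
    subset_convexHull ℝ F (Or.inr (Or.inr ⟨i, rfl⟩))
  have hsup : ∀ i, ∀ x ∈ convexHull ℝ F, suppFun (Real.tan α * z i) (θ i) (x - c) ≤ 1 := by
    intro i
    have hcv : Convex ℝ {x | suppFun (Real.tan α * z i) (θ i) x ≤
        1 + suppFun (Real.tan α * z i) (θ i) c} :=
      convex_halfSpace_le (suppFun (Real.tan α * z i) (θ i)).isLinear _
    intro x hx
    have : x ∈ {x | suppFun (Real.tan α * z i) (θ i) x ≤
        1 + suppFun (Real.tan α * z i) (θ i) c} := by
      refine convexHull_min ?_ hcv hx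
      rintro y (rfl | ⟨j, rfl⟩ | ⟨j, rfl⟩)
      · simp
      · obtain ⟨k, hkn, rfl⟩ : ∃ k : ℕ, k < n ∧ j = i + k :=
          ⟨(j - i).val, ZMod.val_lt _, by rw [ZMod.natCast_zmod_val]; ring⟩
        have := hF.suppFun_le_one (hz i) hkn
        rw [Set.mem_ofPred_eq, hF.vertex, map_add, suppFun_circ]
        linarith
      · have := hF.suppFun_apex_le_one hz (hu j).le (hv j).le (h1 j) (h2 j) i
        rw [Set.mem_ofPred_eq, map_add]
        linarith
    rw [map_sub]
    have := Set.mem_ofPred_eq ▸ this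
    linarith
  have hcvx := convex_convexHull ℝ F
  have hnn : ∀ i, 0 ≤ sideExcess (1 - Real.cos (2 * α)) z i := fun i =>
    excess_nonneg hM1 (b i).1 (b (i + 1)).2.2.1 (b i).2.1 (b (i + 1)).2.2.2
  set T : ZMod n → Set Plane := fun i => triMap (circ (θ i)) (q i) '' openStdTriangle ∪
    triMap (q i) (circ (θ i + 2 * α)) '' openStdTriangle with hT
  have hTm : ∀ i, NullMeasurableSet (T i) := fun i =>
    (nullMeasurableSet_triangle _ _).union (nullMeasurableSet_triangle _ _)
  have hTsub : (⋃ i, T i) ⊆ (fun x => c + x) ⁻¹' convexHull ℝ F := by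
    refine Set.iUnion_subset fun i => Set.union_subset ?_ ?_
    · refine triangle_subset hcvx hcF ?_ (hqF i)
      rw [← hF.vertex_self]; exact hpF i
    · refine triangle_subset hcvx hcF (hqF i) ?_
      rw [← hF.vertex_next]; exact hpF _
  have hTcone : ∀ i, ∀ x ∈ T i, ∃ a b : ℝ, 0 < a ∧ 0 < b ∧
      x = a • circ (θ i) + b • circ (θ i + 2 * α) := by
    rintro i _ (⟨w, ⟨w0, w1, -⟩, rfl⟩ | ⟨w, ⟨w0, w1, -⟩, rfl⟩)
    · refine ⟨w 0 + w 1 * u i, w 1 * v i, ?_, ?_, ?_⟩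
      · have := hu i; positivity
      · have := hv i; positivity
      · rw [triMap_apply]; simp only [hq]; module
    · refine ⟨w 0 * u i, w 0 * v i + w 1, ?_, ?_, ?_⟩
      · have := hu i; positivity
      · have := hv i; positivity
      · rw [triMap_apply]; simp only [hq]; module
  have hTdisj : Pairwise (Function.onFun (AEDisjoint volume) T) := by
    intro i j hij
    apply Disjoint.aedisjoint
    rw [Set.disjoint_left]
    intro x hx hx'
    obtain ⟨a, b, ha, hb, hab⟩ := hTcone i x hx
    obtain ⟨a', b', ha', hb', hab'⟩ := hTcone j x hx'
    exact hij (hF.sector_disjoint ha hb ha' hb' (hab.symm.trans hab'))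
  have hTvol : ∀ i, volume (T i) = ENNReal.ofReal
      (Real.sin (2 * α) / 2 * (1 + sideExcess (1 - Real.cos (2 * α)) z i)) := by
    intro i
    have c1 : cross (circ (θ i)) (q i) = v i * Real.sin (2 * α) := by
      simp only [hq]; rw [cross_add_right, cross_self, cross_circ]; ring
    have c2 : cross (q i) (circ (θ i + 2 * α)) = u i * Real.sin (2 * α) := by
      simp only [hq]; rw [cross_add_left, cross_self, cross_circ]; ring
    have hd : Disjoint (triMap (circ (θ i)) (q i) '' openStdTriangle)
        (triMap (q i) (circ (θ i + 2 * α)) '' openStdTriangle) := by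
      apply disjoint_triangle
      · rw [c1]; exact mul_pos (hv i) hs
      · rw [c2]; exact mul_pos (hu i) hs
    simp only [hT]
    rw [measure_union₀ (nullMeasurableSet_triangle _ _) hd.aedisjoint, volume_openTriangle,
      volume_openTriangle, c1, c2, abs_of_pos (mul_pos (hv i) hs), abs_of_pos (mul_pos (hu i) hs),
      ← ENNReal.ofReal_add (by have := mul_pos (hv i) hs; positivity)
        (by have := mul_pos (hu i) hs; positivity)]
    unfold sideExcess
    rw [← huv i]
    congr 1; ring
  have hvol : ENNReal.ofReal (Real.sin (2 * α) / 2 *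
      ∑ i, (1 + sideExcess (1 - Real.cos (2 * α)) z i)) ≤ volume (convexHull ℝ F) := by
    rw [← measure_preimage_add volume c (convexHull ℝ F)]
    refine le_trans (le_of_eq ?_) (measure_mono hTsub)
    rw [measure_iUnion₀ hTdisj hTm, tsum_fintype, Finset.mul_sum,
      ENNReal.ofReal_sum_of_nonneg fun i _ => mul_nonneg (by positivity) (by linarith [hnn i])]
    exact Finset.sum_congr rfl fun i _ => (hTvol i).symm
  have hpos : 0 < Real.sin (2 * α) / 2 *
      ∑ i, (1 + sideExcess (1 - Real.cos (2 * α)) z i) :=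
    mul_pos (by positivity) (Finset.sum_pos (fun i _ => by linarith [hnn i]) Finset.univ_nonempty)
  -- With empty interior the convex hull would lie in its own frontier, a null set, against its
  -- positive area.
  have hint : (interior (convexHull ℝ F)).Nonempty := by
    rw [Set.nonempty_iff_ne_empty]
    intro hempty
    have h0 : volume (convexHull ℝ F) = 0 := by
      refine measure_mono_null (fun x hx => ?_) (hcvx.addHaar_frontier volume)
      exact ⟨subset_closure hx, by rw [hempty]; exact id⟩
    rw [h0] at hvol
    exact absurd hvol (not_le.2 (ENNReal.ofReal_pos.2 hpos))
  refine ⟨convexHull ℝ F, ⟨⟨⟨F, hfin, rfl⟩, hint⟩, ?_, fun i => ?_⟩, hsup, ?_⟩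
  · exact convexHull_mono fun x hx => Or.inr (Or.inl hx)
  · have h3 := suppFun_circ (Real.tan α * z i) (θ i) 0
    rw [add_zero, Real.cos_zero, Real.sin_zero, mul_zero, add_zero] at h3
    refine mem_frontier_of_forall_le (suppFun (Real.tan α * z i) (θ i)) (v := circ (θ i)) (hpF i)
      (fun y hy => ?_) (by rw [h3]; norm_num)
    have := hsup i y hy
    rw [map_sub] at this
    rw [hF.vertex_self, map_add, h3]
    linarith
  · exact (ENNReal.ofReal_le_iff_le_toReal
      ((hfin.isCompact_convexHull ℝ).measure_lt_top).ne).1 hvol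

/-- A side without excess is used. -/
theorem side_subset_frontier (hF : Frame p c θ α) [NeZero n] {Q : Set Plane}
    (hQ : IsCircumscribed p Q) {z : ZMod n → ℝ} (hz : Slopes z)
    (hsup : ∀ i, ∀ x ∈ Q, suppFun (Real.tan α * z i) (θ i) (x - c) ≤ 1) {i : ZMod n}
    (hi : sideExcess (1 - Real.cos (2 * α)) z i = 0) : side p i ⊆ frontier Q := by
  have hM : 0 < 1 - Real.cos (2 * α) := by linarith [hF.cos_two_lt_one]
  have hM1 : 1 - Real.cos (2 * α) < 1 := by linarith [hF.cos_two_pos]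
  have b := fun j => slope_mem_Icc hM.le (hz j)
  have hpQ : ∀ j, p j ∈ Q := fun j => hQ.2.1 (subset_convexHull ℝ _ ⟨j, rfl⟩)
  have hconv : Convex ℝ Q := by
    obtain ⟨⟨⟨F, -, rfl⟩, -⟩, -⟩ := hQ
    exact convex_convexHull ℝ F
  have key : ∀ f : Plane →L[ℝ] ℝ, (∀ x ∈ Q, f (x - c) ≤ 1) → f (circ (θ i)) = 1 →
      f (circ (θ i + 2 * α)) = 1 → side p i ⊆ frontier Q := by
    rintro f hf f0 f1 _ ⟨s, t, hs, ht, hst, rfl⟩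
    refine mem_frontier_of_forall_le f (v := circ (θ i)) (hconv (hpQ _) (hpQ _) hs ht hst)
      (fun y hy => ?_) (by rw [f0]; norm_num)
    have := hf y hy
    rw [map_sub] at this
    rw [hF.vertex_self, hF.vertex_next, map_add, map_smul, map_smul, map_add, map_add, f0, f1,
      ← add_smul, hst, one_smul]
    linarith
  -- Zero excess means that one of the two supporting lines already contains the side.
  have hor : (1 - Real.cos (2 * α)) * (1 - z i) = 0 ∨
      (1 - Real.cos (2 * α)) * (1 + z (i + 1)) = 0 := by
    by_contra hcon
    push Not at hcon
    have := (excess_pos_iff hM1 (b i).1 (b (i + 1)).2.2.1 (b i).2.1 (b (i + 1)).2.2.2).2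
      ⟨(b i).1.lt_of_ne hcon.1.symm, (b (i + 1)).2.2.1.lt_of_ne hcon.2.symm⟩
    unfold sideExcess at hi
    linarith
  rcases hor with h0 | h0
  · have h1 := hF.suppFun_left (z i) i 1 0
    have h2 := hF.suppFun_left (z i) i 0 1
    rw [h0] at h1 h2
    simp only [one_smul, zero_smul, add_zero, zero_add, sub_zero, mul_zero, mul_one] at h1 h2
    exact key _ (hsup i) h1 h2
  · have h1 := hF.suppFun_right (z (i + 1)) i 1 0
    have h2 := hF.suppFun_right (z (i + 1)) i 0 1
    rw [h0] at h1 h2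
    simp only [one_smul, zero_smul, add_zero, zero_add, sub_zero, mul_zero, mul_one] at h1 h2
    exact key _ (hsup (i + 1)) h1 h2

end Frame

/-! ### Patterns as words -/

section words

open Classical in
/-- The label of the side `j` in the extremal pattern. -/
def patternLabel (m j : ℕ) : Label := if IsUsed m j then Label.U else Label.N

theorem patternLabel_of_isUsed {m j : ℕ} (h : IsUsed m j) : patternLabel m j = Label.U := if_pos h

theorem patternLabel_of_not_isUsed {m j : ℕ} (h : ¬ IsUsed m j) : patternLabel m j = Label.N :=
  if_neg h

theorem patternLabel_congr {m j m' j' : ℕ} (h : IsUsed m j ↔ IsUsed m' j') :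
    patternLabel m j = patternLabel m' j' := by
  by_cases h1 : IsUsed m' j'
  · rw [patternLabel_of_isUsed h1, patternLabel_of_isUsed (h.2 h1)]
  · rw [patternLabel_of_not_isUsed h1, patternLabel_of_not_isUsed fun h2 => h1 (h.1 h2)]

theorem wordUN_succ (k : ℕ) : wordUN (k + 1) = Label.U :: Label.N :: wordUN k := by
  simp [wordUN, List.replicate_succ]

theorem patternLabel_zero_add_two (j : ℕ) : patternLabel 0 (j + 2) = patternLabel 0 j := by
  have h : IsUsed 0 (j + 2) ↔ IsUsed 0 j := by
    unfold IsUsed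
    rcases Nat.eq_zero_or_pos j with rfl | hj
    · simp
    · simp [Nat.even_add, hj.ne']
  exact patternLabel_congr h

theorem getElem?_wordUN (k j : ℕ) :
    (wordUN k)[j]? = if j < 2 * k then some (patternLabel 0 j) else none := by
  induction k generalizing j with
  | zero => simp [wordUN]
  | succ k ih =>
    rw [wordUN_succ]
    match j with
    | 0 => simp [patternLabel, IsUsed]
    | 1 => simp [patternLabel, IsUsed]; omega
    | j + 2 =>
      rw [List.getElem?_cons_succ, List.getElem?_cons_succ, ih, patternLabel_zero_add_two]
      simp only [show j + 2 < 2 * (k + 1) ↔ j < 2 * k by omega]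

/-- The initial U together with m letters N is a block of m + 1 sides, hence the shift of the
parameter. -/
theorem getElem?_wordUNUN (m k j : ℕ) :
    (wordUNUN m k)[j]? = if j < m + 1 + 2 * k then some (patternLabel (m + 1) j) else none := by
  unfold wordUNUN
  match j with
  | 0 => simp [patternLabel, IsUsed]
  | j + 1 =>
    rw [List.getElem?_cons_succ]
    rcases Nat.lt_or_ge j m with h | h
    · rw [List.getElem?_append_left (by simpa using h), List.getElem?_replicate, if_pos h,
        if_pos (by omega)]
      have : ¬ IsUsed (m + 1) (j + 1) := by
        unfold IsUsed; omega
      simp [patternLabel, this]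
    · rw [List.getElem?_append_right (by simpa using h), List.length_replicate, getElem?_wordUN]
      have e : IsUsed (m + 1) (j + 1) ↔ IsUsed 0 (j - m) := by
        unfold IsUsed
        rw [show j + 1 - (m + 1) = j - m by omega, Nat.sub_zero]
        constructor
        · rintro (h1 | h1)
          · omega
          · exact Or.inr ⟨by omega, h1.2⟩
        · rintro (h1 | h1)
          · exact Or.inr ⟨by omega, by simp [h1]⟩
          · exact Or.inr ⟨by omega, h1.2⟩
      simp only [patternLabel_congr e, show j - m < 2 * k ↔ j + 1 < m + 1 + 2 * k by omega]

theorem rotate_assignedSequence {n : ℕ} [NeZero n] {p : ZMod n → Plane} {Q : Set Plane} {m : ℕ}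
    {a : ZMod n} (ha : ∀ j < n, side p (a + (j : ℕ)) ⊆ frontier Q ↔ IsUsed m j)
    {w : List Label} (hw : ∀ j, w[j]? = if j < n then some (patternLabel m j) else none) :
    (assignedSequence p Q).rotate a.val = w := by
  have hlen : (assignedSequence p Q).length = n := by simp [assignedSequence]
  apply List.ext_getElem?
  intro j
  rw [hw]
  split_ifs with hj
  · rw [List.getElem?_rotate (by rw [hlen]; exact hj), hlen]
    have hlt : (j + a.val) % n < n := Nat.mod_lt _ (NeZero.pos n)
    unfold assignedSequence
    rw [List.getElem?_ofFn, dif_pos hlt]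
    have e : (((j + a.val) % n : ℕ) : ZMod n) = a + (j : ℕ) := by
      rw [ZMod.natCast_mod, Nat.cast_add, ZMod.natCast_zmod_val, add_comm]
    simp only [e]
    by_cases hu : IsUsed m j
    · rw [patternLabel_of_isUsed hu, sideLabel, if_pos ((ha j hj).2 hu)]
    · rw [patternLabel_of_not_isUsed hu, sideLabel, if_neg fun h => hu ((ha j hj).1 h)]
  · rw [List.getElem?_eq_none_iff, List.length_rotate, hlen]
    omega

end words

/-! ### From the optimization to maximum area polygons -/

namespace Frame

variable {n : ℕ} {p : ZMod n → Plane} {c : Plane} {θ : ZMod n → ℝ} {α : ℝ}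

theorem value_eq (hF : Frame p c θ α) (X : ℝ) :
    Real.sin (2 * α) / 2 * (n + (n * Real.tan α ^ 2 + Real.tan α ^ 3 * X)) =
      n * Real.tan α + Real.sin α ^ 4 / Real.cos α ^ 2 * X := by
  have hc := hF.cos_pos.ne'
  rw [Real.sin_two_mul, Real.tan_eq_sin_div_cos]
  field_simp
  linear_combination n * Real.sin α * Real.cos α * Real.sin_sq_add_cos_sq α

variable [NeZero n]

theorem sum_one_add_sideExcess (z : ZMod n → ℝ) (M : ℝ) :
    ∑ i, (1 + sideExcess M z i) = n + totalExcess M z := by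
  rw [Finset.sum_add_distrib]
  simp [totalExcess, sideExcess, ZMod.card]

theorem area_le_totalExcess (hF : Frame p c θ α) {Q : Set Plane} {z : ZMod n → ℝ} (hz : Slopes z)
    (hsup : ∀ i, ∀ x ∈ Q, suppFun (Real.tan α * z i) (θ i) (x - c) ≤ 1) :
    area Q ≤ Real.sin (2 * α) / 2 * (n + totalExcess (1 - Real.cos (2 * α)) z) := by
  have := hF.area_le hz hsup ∅ (by simp)
  simpa [sum_one_add_sideExcess] using this

theorem bddAbove (hF : Frame p c θ α) : BddAbove (circumscribedAreas p) := by
  obtain ⟨w, -, hmax⟩ := exists_isMaxOn_totalExcess (n := n) (M := 1 - Real.cos (2 * α))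
    (by linarith [hF.cos_two_lt_one]) (by linarith [hF.cos_two_pos])
  refine ⟨Real.sin (2 * α) / 2 * (n + totalExcess (1 - Real.cos (2 * α)) w), ?_⟩
  rintro _ ⟨Q, hQ, rfl⟩
  obtain ⟨z, hz, hsup⟩ := hF.exists_slopes hQ
  have hs := hF.sin_pos
  refine (hF.area_le_totalExcess hz hsup).trans ?_
  have := hmax z hz
  gcongr

variable {V : ℝ} {m : ℕ}

theorem maxArea_eq (hF : Frame p c θ α) (hV : IsOptimum n (1 - Real.cos (2 * α)) V m) :
    maxArea p = Real.sin (2 * α) / 2 * (n + V) := by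
  have hs := hF.sin_pos
  have hub : ∀ Q, IsCircumscribed p Q → area Q ≤ Real.sin (2 * α) / 2 * (n + V) := by
    intro Q hQ
    obtain ⟨z, hz, hsup⟩ := hF.exists_slopes hQ
    refine (hF.area_le_totalExcess hz hsup).trans ?_
    have := hV.le z hz
    gcongr
  obtain ⟨z, hz, hzV, -⟩ := hV.attained
  obtain ⟨Q, hQ, -, hQa⟩ := hF.exists_isCircumscribed hz
  rw [sum_one_add_sideExcess, hzV] at hQa
  apply IsGreatest.csSup_eq
  refine ⟨⟨Q, hQ, le_antisymm (hub Q hQ) hQa⟩, ?_⟩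
  rintro _ ⟨Q', hQ', rfl⟩
  exact hub Q' hQ'

/-- For a polygon of maximum area, the slopes of supporting lines are optimal, and the used sides
are those without excess. -/
theorem side_subset_iff (hF : Frame p c θ α) (hV : IsOptimum n (1 - Real.cos (2 * α)) V m)
    {Q : Set Plane} (hQ : IsMaxAreaCircumscribed p Q) {z : ZMod n → ℝ} (hz : Slopes z)
    (hsup : ∀ i, ∀ x ∈ Q, suppFun (Real.tan α * z i) (θ i) (x - c) ≤ 1) :
    totalExcess (1 - Real.cos (2 * α)) z = V ∧
    ∀ i, side p i ⊆ frontier Q ↔ sideExcess (1 - Real.cos (2 * α)) z i = 0 := by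
  have hs := hF.sin_pos
  have hM : 0 ≤ 1 - Real.cos (2 * α) := by linarith [hF.cos_two_lt_one]
  have hM1 : 1 - Real.cos (2 * α) < 1 := by linarith [hF.cos_two_pos]
  have b := fun j => slope_mem_Icc hM (hz j)
  have hnn : ∀ i, 0 ≤ sideExcess (1 - Real.cos (2 * α)) z i := fun i =>
    excess_nonneg hM1 (b i).1 (b (i + 1)).2.2.1 (b i).2.1 (b (i + 1)).2.2.2
  have hle := hV.le z hz
  have hmax := hQ.2
  rw [hF.maxArea_eq hV] at hmax
  have h1 := hF.area_le_totalExcess hz hsup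
  rw [hmax] at h1
  have h2 := le_of_mul_le_mul_left h1 (by positivity)
  refine ⟨by linarith, fun i => ⟨fun hi => ?_, hF.side_subset_frontier hQ.1 hz hsup⟩⟩
  -- If side i is used, the area bound survives without its excess. As the area equals the full
  -- optimum, that excess must be zero.
  have h3 := hF.area_le hz hsup {i} (by
    intro j hj u v huv
    rw [Finset.mem_singleton] at hj
    subst hj
    exact hF.add_le_one_of_side_subset hQ.1 hi huv)
  rw [hmax] at h3
  have h4 := le_of_mul_le_mul_left h3 (by positivity)
  have h5 : ∑ j, (1 + if j ∈ ({i} : Finset (ZMod n)) then 0 else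
      sideExcess (1 - Real.cos (2 * α)) z j) =
      ∑ j, (1 + sideExcess (1 - Real.cos (2 * α)) z j) -
        sideExcess (1 - Real.cos (2 * α)) z i := by
    rw [eq_sub_iff_add_eq, ← Fintype.sum_ite_eq i (sideExcess (1 - Real.cos (2 * α)) z),
      ← Finset.sum_add_distrib]
    refine Finset.sum_congr rfl fun j _ => ?_
    by_cases hj : j = i
    · subst hj; simp
    · simp [hj, Ne.symm hj]
  rw [h5, sum_one_add_sideExcess] at h4
  exact le_antisymm (by linarith) (hnn i)

theorem exists_isMaxAreaCircumscribed (hF : Frame p c θ α)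
    (hV : IsOptimum n (1 - Real.cos (2 * α)) V m) :
    ∃ Q, IsMaxAreaCircumscribed p Q ∧
      ∀ j < n, side p ((0 : ZMod n) + (j : ℕ)) ⊆ frontier Q ↔ IsUsed m j := by
  obtain ⟨z, hz, hzV, hpat⟩ := hV.attained
  obtain ⟨Q, hQ, hsup, hQa⟩ := hF.exists_isCircumscribed hz
  have hmax : IsMaxAreaCircumscribed p Q := by
    refine ⟨hQ, le_antisymm ?_ ?_⟩
    · rw [hF.maxArea_eq hV, ← hzV]
      exact hF.area_le_totalExcess hz hsup
    · rwa [hF.maxArea_eq hV, ← hzV, ← sum_one_add_sideExcess]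
  refine ⟨Q, hmax, fun j hj => ?_⟩
  rw [(hF.side_subset_iff hV hmax hz hsup).2, zero_add]
  exact hpat j hj

theorem exists_pattern (hF : Frame p c θ α)
    (hV : IsOptimum n (1 - Real.cos (2 * α)) V m) {Q : Set Plane}
    (hQ : IsMaxAreaCircumscribed p Q) :
    ∃ a : ZMod n, ∀ j < n, side p (a + (j : ℕ)) ⊆ frontier Q ↔ IsUsed m j := by
  obtain ⟨z, hz, hsup⟩ := hF.exists_slopes hQ.1
  obtain ⟨h1, h2⟩ := hF.side_subset_iff hV hQ hz hsup
  obtain ⟨a, ha⟩ := hV.pattern z hz h1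
  exact ⟨a, fun j hj => by rw [h2]; exact ha j hj⟩

theorem words_of_isOptimum (hF : Frame p c θ α)
    (hV : IsOptimum n (1 - Real.cos (2 * α)) V m) {w : List Label}
    (hw : ∀ j, w[j]? = if j < n then some (patternLabel m j) else none) :
    (∃ Q, IsMaxAreaCircumscribed p Q ∧ assignedSequence p Q = w) ∧
      ∀ Q, IsMaxAreaCircumscribed p Q → List.IsRotated (assignedSequence p Q) w := by
  constructor
  · obtain ⟨Q, hQ, hpat⟩ := hF.exists_isMaxAreaCircumscribed hV
    refine ⟨Q, hQ, ?_⟩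
    have := rotate_assignedSequence hpat hw
    rwa [ZMod.val_zero, List.rotate_zero] at this
  · intro Q hQ
    obtain ⟨a, ha⟩ := hF.exists_pattern hV hQ
    exact ⟨a.val, rotate_assignedSequence ha hw⟩

end Frame

/-! ### Closed formulas and the three residue cases -/

theorem oddValue_eq {n m : ℕ} {x : ℝ} (hx : m * (Real.pi / n) = Real.pi / 2 - x) :
    oddValue (Real.pi / n) n m =
      ((n : ℝ) - m) / 2 * Real.tan (2 * Real.pi / n) - Real.tan x := by
  unfold oddValue
  rw [hx, Real.cos_pi_div_two_sub, Real.sin_pi_div_two_sub, ← Real.tan_eq_sin_div_cos,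
    mul_div_assoc]
  ring

end CircumscribedPolygon

end

theorem mainTheorem6 (n : ℕ) (hn : 5 ≤ n) (p : ZMod n → CircumscribedPolygon.Plane)
    (hp : CircumscribedPolygon.IsUnitRegularNgon p) :
    BddAbove (CircumscribedPolygon.circumscribedAreas p) ∧
    (2 ∣ n →
      CircumscribedPolygon.maxArea p =
        n * Real.tan (Real.pi / n) +
          (n : ℝ) / 2 * (Real.sin (Real.pi / n) ^ 4 / Real.cos (Real.pi / n) ^ 2) *
            Real.tan (2 * Real.pi / n) ∧
      (∃ Q, CircumscribedPolygon.IsMaxAreaCircumscribed p Q ∧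
        CircumscribedPolygon.assignedSequence p Q = CircumscribedPolygon.wordUN (n / 2)) ∧
      ∀ Q, CircumscribedPolygon.IsMaxAreaCircumscribed p Q →
        List.IsRotated (CircumscribedPolygon.assignedSequence p Q)
          (CircumscribedPolygon.wordUN (n / 2))) ∧
    (4 ∣ n - 1 →
      CircumscribedPolygon.maxArea p =
        n * Real.tan (Real.pi / n) +
          Real.sin (Real.pi / n) ^ 4 / Real.cos (Real.pi / n) ^ 2 *
            (((n : ℝ) + 3) / 4 * Real.tan (2 * Real.pi / n) -
              Real.tan (3 * Real.pi / (2 * n))) ∧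
      (∃ Q, CircumscribedPolygon.IsMaxAreaCircumscribed p Q ∧
        CircumscribedPolygon.assignedSequence p Q =
          CircumscribedPolygon.wordUNUN ((n - 5) / 2) ((n + 3) / 4)) ∧
      ∀ Q, CircumscribedPolygon.IsMaxAreaCircumscribed p Q →
        List.IsRotated (CircumscribedPolygon.assignedSequence p Q)
          (CircumscribedPolygon.wordUNUN ((n - 5) / 2) ((n + 3) / 4))) ∧
    (4 ∣ n + 1 →
      CircumscribedPolygon.maxArea p =
        n * Real.tan (Real.pi / n) +
          Real.sin (Real.pi / n) ^ 4 / Real.cos (Real.pi / n) ^ 2 *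
            (((n : ℝ) + 1) / 4 * Real.tan (2 * Real.pi / n) -
              Real.tan (Real.pi / (2 * n))) ∧
      (∃ Q, CircumscribedPolygon.IsMaxAreaCircumscribed p Q ∧
        CircumscribedPolygon.assignedSequence p Q =
          CircumscribedPolygon.wordUNUN ((n - 3) / 2) ((n + 1) / 4)) ∧
      ∀ Q, CircumscribedPolygon.IsMaxAreaCircumscribed p Q →
        List.IsRotated (CircumscribedPolygon.assignedSequence p Q)
          (CircumscribedPolygon.wordUNUN ((n - 3) / 2) ((n + 1) / 4))) := by
  open CircumscribedPolygon in
  have : NeZero n := ⟨by omega⟩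
  have hn0 : (n : ℝ) ≠ 0 := by exact_mod_cast NeZero.ne n
  obtain ⟨c, θ, hF⟩ := exists_frame hn hp
  refine ⟨hF.bddAbove, fun h => ?_, fun h => ?_, fun h => ?_⟩
  · have hV := isOptimum_of_even hn hF.angle hF.alpha_pos hF.two_alpha_lt (even_iff_two_dvd.2 h)
    refine ⟨?_, hF.words_of_isOptimum hV fun j => ?_⟩
    · rw [hF.maxArea_eq hV, hF.value_eq, mul_div_assoc 2 Real.pi]
      ring
    · rw [getElem?_wordUN, Nat.mul_div_cancel' h]
  · obtain ⟨k, hk⟩ := h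
    obtain ⟨l, rfl⟩ : ∃ l, k = l + 1 := ⟨k - 1, by omega⟩
    obtain rfl : n = 4 * l + 5 := by omega
    -- The largest odd number below n/2 = 2l + 5/2 is 2l + 1, so mα falls short of π/2 by 3π/(2n).
    have hV := isOptimum_of_odd (m := 2 * l + 1) hn hF.angle hF.alpha_pos hF.two_alpha_lt
      ⟨2 * l + 2, by ring⟩ ⟨l, rfl⟩ (by omega) (by omega)
    refine ⟨?_, hF.words_of_isOptimum hV fun j => ?_⟩
    · rw [hF.maxArea_eq hV, hF.value_eq,
        oddValue_eq (x := 3 * Real.pi / (2 * (4 * l + 5 : ℕ)))]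
      · push_cast
        ring
      · field_simp
        push_cast
        ring
    · rw [getElem?_wordUNUN, show (4 * l + 5 - 5) / 2 = 2 * l by omega,
        show (4 * l + 5 + 3) / 4 = l + 2 by omega,
        show 2 * l + 1 + 2 * (l + 2) = 4 * l + 5 by ring]
  · obtain ⟨k, hk⟩ := h
    -- The value k = 1 would mean n = 3, so the family starts at n = 7.
    obtain ⟨l, rfl⟩ : ∃ l, k = l + 2 := ⟨k - 2, by omega⟩
    obtain rfl : n = 4 * l + 7 := by omega
    -- Here n/2 = 2l + 7/2, so m = 2l + 3 and mα falls short of π/2 by π/(2n).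
    have hV := isOptimum_of_odd (m := 2 * l + 3) hn hF.angle hF.alpha_pos hF.two_alpha_lt
      ⟨2 * l + 3, by ring⟩ ⟨l + 1, by ring⟩ (by omega) (by omega)
    refine ⟨?_, hF.words_of_isOptimum hV fun j => ?_⟩
    · rw [hF.maxArea_eq hV, hF.value_eq,
        oddValue_eq (x := Real.pi / (2 * (4 * l + 7 : ℕ)))]
      · push_cast
        ring
      · field_simp
        push_cast
        ring
    · rw [getElem?_wordUNUN, show (4 * l + 7 - 3) / 2 = 2 * l + 2 by omega,
        show (4 * l + 7 + 1) / 4 = l + 2 by omega,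
        show 2 * l + 2 + 1 + 2 * (l + 2) = 4 * l + 7 by ring]
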